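/- Fix $0\le T<\infty$, $d,k\in\mathbb N$, $x_0\in\mathbb R^d$, $l_1,\dots,l_k\in\mathbb Z^d$, and independent rate-$1$ Poisson processes $Y_1,\dots,Y_k$ on a probability space. Let $f_1,\dots,f_k:[0,T]\times\mathbb R^d\to\mathbb R$ be continuous and put $F(t,x)=\sum_{i=1}^k l_i f_i(t,x)$. Assume that there are finite constants $C_i$ and $M$ such that, for all $t\in[0,T]$ and $x,y\in\mathbb R^d$, $$|f_i(t,x)|\le C_i(1+|x|)\quad(i=1,\dots,k),\qquad |F(t,x)-F(t,y)|\le M|x-y| .$$ Let $X$ be a solution on $[0,T]$ of $$X(t)=x_0+\sum_{i=1}^k l_i\,Y_i\Big(\int_0^t f_i(s,X(s))\,ds\Big),$$ let $\mu(t)=E[X(t)]$, and define the adjusted rates by translating the law of $X(t)-\mu(t)$: $$g_i(t,m)=E\big[f_i(t,\,X(t)-\mu(t)+m)\big]\quad(t\in[0,T],\ m\in\mathbb R^d),\qquad\text{so that } g_i(t,\mu(t))=E[f_i(t,X(t))].$$ For every $n\ge1$ let $Z_n$ be a solution on $[0,T]$ of $$Z_n(t)=x_0+\sum_{i=1}^k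 \frac1n\, l_i\,Y_i\Big(\int_0^t n\,g_i(s,Z_n(s))\,ds\Big).$$ (A solution of such an equation is a process along whose paths, almost surely, the rates are nonnegative and integrable on $[0,T]$, so that the right-hand side makes sense, and the equation holds for all $t\in[0,T]$; the nonnegativity is automatic if $f_i\ge0$.) Then all the expectations above, and the integrals below, exist and are finite; the integral equation $$\bar Z(t)=x_0+\sum_{i=1}^k l_i\int_0^t g_i(s,\bar Z(s))\,ds,\qquad t\in[0,T],$$ has a unique solution $\bar Z$; almost surely $\lim_{n\to\infty}Z_n(t)=\bar Z(t)$ uniformly in $t\in[0,T]$; and for all $t\in[0,T]$ $$\bar Z(t)=E[X(t)]=x_0+\sum_{i=1}^k l_i\int_0^t E\big[f_i(s,X(s))\big]\,ds .$$ -/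

import Mathlib

open MeasureTheory ProbabilityTheory Set Filter Topology
open scoped NNReal

namespace AdjustedFluid

noncomputable section

/-- `Y : ℝ≥0 → Ω → ℕ` is a (homogeneous) Poisson process of rate `1`: a counting process started
at `0`, with right-continuous nondecreasing paths, independent increments, and increments over
`(s, t]` that are Poisson distributed with parameter `t - s`. (The increments are truncated
differences in `ℕ`; they are the true ones since almost every path is nondecreasing.) -/
structure IsUnitPoissonProcess {Ω : Type*} [MeasurableSpace Ω] (P : Measure Ω)
    (Y : ℝ≥0 → Ω → ℕ) : Prop where
  measurable : ∀ t, Measurable (Y t)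
  zero : ∀ᵐ ω ∂P, Y 0 ω = 0
  monotone : ∀ᵐ ω ∂P, Monotone fun t => Y t ω
  rightCont : ∀ᵐ ω ∂P, ∀ t, ContinuousWithinAt (fun u => Y u ω) (Ici t) t
  indepIncrements : HasIndepIncrements Y P
  increments : ∀ s t : ℝ≥0, s ≤ t →
    HasLaw (fun ω => Y t ω - Y s ω) (poissonMeasure (t - s)) P

/-- An integer vector `v ∈ ℤ^d` seen in Euclidean space `ℝ^d`. -/
def toEuclidean {d : ℕ} (v : Fin d → ℤ) : EuclideanSpace ℝ (Fin d) :=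
  WithLp.toLp 2 fun j => (v j : ℝ)

/-- The drift `F(t,x) = ∑ i, l_i f_i(t,x)`. -/
def drift {d k : ℕ} (l : Fin k → Fin d → ℤ)
    (f : Fin k → ℝ → EuclideanSpace ℝ (Fin d) → ℝ) (t : ℝ) (x : EuclideanSpace ℝ (Fin d)) :
    EuclideanSpace ℝ (Fin d) :=
  ∑ i, f i t x • toEuclidean (l i)

/-- The process `X` is, on `[0,T]`, a solution to
`X(t) = x₀ + ∑ i, (1/n) l_i Y_i (∫₀ᵗ n r_i(s, X(s)) ds)`.
For the right-hand side to make sense, the rates have to be integrable and nonnegative along the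
path (`Y_i` is only indexed by `[0,∞)`); the nonnegativity is automatic when `r_i ≥ 0`.
For `n = 1` this is the unscaled equation. -/
structure IsScaledSolution {d k : ℕ} {Ω : Type*} [MeasurableSpace Ω] (P : Measure Ω) (T : ℝ)
    (x₀ : EuclideanSpace ℝ (Fin d)) (l : Fin k → Fin d → ℤ) (Y : Fin k → ℝ≥0 → Ω → ℕ)
    (r : Fin k → ℝ → EuclideanSpace ℝ (Fin d) → ℝ) (n : ℕ)
    (X : ℝ → Ω → EuclideanSpace ℝ (Fin d)) : Prop where
  measurable : ∀ t ∈ Icc 0 T, Measurable (X t)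
  nonneg : ∀ᵐ ω ∂P, ∀ i, ∀ t ∈ Icc 0 T, 0 ≤ r i t (X t ω)
  integrable : ∀ᵐ ω ∂P, ∀ i, IntervalIntegrable (fun s => r i s (X s ω)) volume 0 T
  equation : ∀ᵐ ω ∂P, ∀ t ∈ Icc 0 T,
    X t ω = x₀ + ∑ i, ((1 / (n : ℝ)) *
      (Y i (∫ s in (0 : ℝ)..t, (n : ℝ) * r i s (X s ω)).toNNReal ω : ℝ)) • toEuclidean (l i)

/-- The deterministic function `z` is, on `[0,T]`, a solution to the fluid equation
`z(t) = x₀ + ∑ i, l_i ∫₀ᵗ r_i(s, z(s)) ds`. -/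
structure IsFluidSolution {d k : ℕ} (T : ℝ)
    (x₀ : EuclideanSpace ℝ (Fin d)) (l : Fin k → Fin d → ℤ)
    (r : Fin k → ℝ → EuclideanSpace ℝ (Fin d) → ℝ) (z : ℝ → EuclideanSpace ℝ (Fin d)) :
    Prop where
  integrable : ∀ i, IntervalIntegrable (fun s => r i s (z s)) volume 0 T
  equation : ∀ t ∈ Icc 0 T,
    z t = x₀ + ∑ i, (∫ s in (0 : ℝ)..t, r i s (z s)) • toEuclidean (l i)

/-- The adjusted rates `g_i(t,m) = E[f_i(t, X(t) - E[X(t)] + m)]`: the mean of `f_i(t,·)` under the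
base distribution of `X(t)` (the law of `X(t) - E[X(t)]`) translated so as to have mean `m`. -/
def adjustedRate {d k : ℕ} {Ω : Type*} [MeasurableSpace Ω] (P : Measure Ω)
    (X : ℝ → Ω → EuclideanSpace ℝ (Fin d))
    (f : Fin k → ℝ → EuclideanSpace ℝ (Fin d) → ℝ)
    (i : Fin k) (t : ℝ) (m : EuclideanSpace ℝ (Fin d)) : ℝ :=
  ∫ ω, f i t (X t ω - (∫ ω', X t ω' ∂P) + m) ∂P

/-- The defining property `g_i(t, E[X(t)]) = E[f_i(t, X(t))]` of the adjusted rates. -/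
theorem adjustedRate_mean {d k : ℕ} {Ω : Type*} [MeasurableSpace Ω] (P : Measure Ω)
    (X : ℝ → Ω → EuclideanSpace ℝ (Fin d))
    (f : Fin k → ℝ → EuclideanSpace ℝ (Fin d) → ℝ) (i : Fin k) (t : ℝ) :
    adjustedRate P X f i t (∫ ω, X t ω ∂P) = ∫ ω, f i t (X t ω) ∂P := by
  simp [adjustedRate]

end

end AdjustedFluid

/-! The mean `μ` of `X` is itself the fluid limit. Taking expectations in the equation for `X` gives
`μ(t) = x₀ + ∑ l_i ∫₀ᵗ E[f_i(s, X(s))] ds`, and the adjusted rates satisfy `g_i(s, μ(s)) = E[f_i(s,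
X(s))]`; hence `μ` solves the fluid equation exactly. The drift of the `g_i` is an average of
translates of `F` and inherits its Lipschitz bound, although no single `g_i` need be Lipschitz.
Grönwall then gives uniqueness and, with the law of large numbers for the `Y_i`, the convergence of
`Z_n` (`IsFluidSolution.norm_sub_le`, `IsFluidSolution.tendstoUniformlyOn`).

The work lies in taking expectations: finite first moments, and `E[Y_i(τ_i)] = E[τ_i]` for the
internal clock `τ_i = ∫₀ᵗ f_i(s, X(s)) ds`. The latter is optional stopping
(`IsUnitPoissonProcess.lintegral_stopped`): up to a null set, the event `τ_i < u` is determined by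
the other processes and by `Y_i` up to `u`, so it is independent of the increments of `Y_i` after
`u`. Adaptedness of `X` is not assumed but deduced from pathwise uniqueness: in terms of jump counts
the paths are right-continuous step functions, and the equation determines them without any
Lipschitz condition (`SolvesUpTo.eqOn`).

For measurability and integrability the rates are switched off once the total count reaches `m`. The
truncated solution `truncSol` is a finite Picard iteration, jointly measurable and with bounded
clocks; optional stopping and Grönwall bound its mean count independently of `m`, because the rates
grow linearly. Almost every path of `X` makes finitely many jumps on `[0, T]`, so it agrees with
`truncSol` for large `m`. Fatou carries the bound over, and optional stopping for the untruncated
clock gives the identity of means (`IsRate.moments`). -/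

namespace AdjustedFluid

/-! ### Pathwise theory of the time change equation: uniqueness. -/

variable {k : ℕ}

/-- The internal clocks `∫₀ᵗ r_i(s, A(s)) ds` of the count path `A`. -/
noncomputable def clock (r : Fin k → ℝ → (Fin k → ℕ) → ℝ) (A : ℝ → Fin k → ℕ) (i : Fin k)
    (t : ℝ) : ℝ :=
  ∫ s in (0 : ℝ)..t, r i s (A s)

/-- The driving paths `W` run along the internal clocks of the count path `A`. -/
noncomputable def timeChange (W : Fin k → ℝ → ℕ) (r : Fin k → ℝ → (Fin k → ℕ) → ℝ)
    (A : ℝ → Fin k → ℕ) : ℝ → Fin k → ℕ :=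
  fun t i => W i (clock r A i t)

/-- The rates, switched off as soon as the total count reaches `m`. -/
def trunc (r : Fin k → ℝ → (Fin k → ℕ) → ℝ) (m : ℕ) (i : Fin k) (t : ℝ) (a : Fin k → ℕ) : ℝ :=
  if ∑ j, a j < m then r i t a else 0

/-- The count path solving the time change equation with truncated rates: raising the truncation
level by one takes two Picard steps. -/
noncomputable def truncSol (W : Fin k → ℝ → ℕ) (r : Fin k → ℝ → (Fin k → ℕ) → ℝ) :
    ℕ → ℝ → Fin k → ℕ
  | 0 => fun _ i => W i 0
  | m + 1 => timeChange W (trunc r (m + 1)) (timeChange W (trunc r (m + 1)) (truncSol W r m))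

/-- A driving path: monotone and right-continuous. -/
structure IsDriver (w : ℝ → ℕ) : Prop where
  mono : Monotone w
  rightCont : ∀ t, ContinuousWithinAt w (Ici t) t

/-- Nonnegative measurable rates of linear growth. -/
structure IsRate (r : Fin k → ℝ → (Fin k → ℕ) → ℝ) (R : ℝ) : Prop where
  nonneg : ∀ i t a, 0 ≤ r i t a
  meas : ∀ i a, Measurable fun t => r i t a
  le : ∀ i t a, r i t a ≤ R * (1 + ∑ j, (a j : ℝ))

/-- `A` solves the time change equation up to time `t`. -/
structure SolvesUpTo (W : Fin k → ℝ → ℕ) (r : Fin k → ℝ → (Fin k → ℕ) → ℝ) (t : ℝ)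
    (A : ℝ → Fin k → ℕ) : Prop where
  integrable : ∀ i, IntervalIntegrable (fun s => r i s (A s)) volume 0 t
  eq : ∀ s ∈ Icc 0 t, A s = timeChange W r A s

theorem IsDriver.exists_eq {w : ℝ → ℕ} (hw : IsDriver w) (t : ℝ) :
    ∃ δ > 0, ∀ v ∈ Ico t (t + δ), w v = w t := by
  have h := hw.rightCont t
  have h1 : w ⁻¹' {w t} ∈ 𝓝[≥] t := h (by simp [nhds_discrete])
  obtain ⟨u, hu, h2⟩ := mem_nhdsGE_iff_exists_Ico_subset.1 h1
  refine ⟨u - t, by simpa using hu, fun v hv => ?_⟩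
  have : v ∈ Ico t u := by simpa using hv
  simpa using h2 this

/-- At the infimum of the failures `step` gives `p`, and `right` then keeps failures away from it.
This stands in for induction over jump times. -/
theorem real_induction {p : ℝ → Prop} {t : ℝ}
    (step : ∀ s ∈ Icc 0 t, (∀ v ∈ Ico 0 s, p v) → p s)
    (right : ∀ s ∈ Ico 0 t, (∀ v ∈ Icc 0 s, p v) → ∃ δ > 0, ∀ v ∈ Ioo s (s + δ), v ≤ t → p v) :
    ∀ s ∈ Icc 0 t, p s := by
  by_contra! hcon
  obtain ⟨s₀, hs₀, hp₀⟩ := hcon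
  set D := {s | s ∈ Icc 0 t ∧ ¬ p s} with hD
  have hne : D.Nonempty := ⟨s₀, hs₀, hp₀⟩
  have hbdd : BddBelow D := ⟨0, fun s hs => hs.1.1⟩
  have hlt : ∀ v ∈ Ico 0 (sInf D), p v := by
    intro v hv
    by_contra hpv
    have h1 : sInf D ≤ s₀ := csInf_le hbdd ⟨hs₀, hp₀⟩
    exact absurd (csInf_le hbdd (show v ∈ D from ⟨⟨hv.1, by linarith [hv.2, hs₀.2]⟩, hpv⟩))
      (not_le.2 hv.2)
  have h0 : 0 ≤ sInf D := le_csInf hne fun s hs => hs.1.1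
  have h1 : sInf D ≤ s₀ := csInf_le hbdd ⟨hs₀, hp₀⟩
  have hp : p (sInf D) := step _ ⟨h0, h1.trans hs₀.2⟩ hlt
  have hle : ∀ v ∈ Icc 0 (sInf D), p v := fun v hv => by
    rcases hv.2.lt_or_eq with h | h
    · exact hlt v ⟨hv.1, h⟩
    · rwa [h]
  have hs : sInf D < s₀ := lt_of_le_of_ne h1 fun h => hp₀ (h ▸ hp)
  obtain ⟨δ, hδ, h2⟩ := right _ ⟨h0, hs.trans_le hs₀.2⟩ hle
  obtain ⟨v, hv, hv2⟩ := exists_lt_of_csInf_lt hne (show sInf D < sInf D + δ by linarith)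
  refine hv.2 ?_
  rcases (csInf_le hbdd hv).lt_or_eq with h | h
  · exact h2 v ⟨h, hv2⟩ hv.1.2
  · rwa [← h]

/-- The endpoint is a null set, so agreement strictly before `t` already fixes the clock at `t`.
Uniqueness rests on this. -/
theorem clock_congr {r r' : Fin k → ℝ → (Fin k → ℕ) → ℝ} {A B : ℝ → Fin k → ℕ} {t : ℝ}
    (ht : 0 ≤ t) (h : ∀ i, ∀ s ∈ Ico 0 t, r i s (A s) = r' i s (B s)) (i : Fin k) :
    clock r A i t = clock r' B i t := by
  refine intervalIntegral.integral_congr_ae ?_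
  have : ∀ᵐ s ∂(volume : Measure ℝ), s ≠ t := by simp [ae_iff, measure_singleton]
  filter_upwards [this] with s hs hst
  rw [uIoc_of_le ht] at hst
  exact h i s ⟨hst.1.le, lt_of_le_of_ne hst.2 hs⟩

theorem clock_mono {r : Fin k → ℝ → (Fin k → ℕ) → ℝ} (hr : ∀ i t a, 0 ≤ r i t a)
    {A : ℝ → Fin k → ℕ} {t : ℝ} {i : Fin k}
    (hint : IntervalIntegrable (fun s => r i s (A s)) volume 0 t)
    {s s' : ℝ} (h0 : 0 ≤ s) (h : s ≤ s') (h' : s' ≤ t) : clock r A i s ≤ clock r A i s' := by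
  refine intervalIntegral.integral_mono_interval le_rfl h0 h (Eventually.of_forall fun _ => hr _ _ _) ?_
  exact hint.mono_set (by
    rw [uIcc_of_le (h0.trans h), uIcc_of_le (h0.trans (h.trans h'))]
    exact Icc_subset_Icc_right h')

theorem clock_nonneg {r : Fin k → ℝ → (Fin k → ℕ) → ℝ} (hr : ∀ i t a, 0 ≤ r i t a)
    (A : ℝ → Fin k → ℕ) (i : Fin k) {t : ℝ} (h0 : 0 ≤ t) : 0 ≤ clock r A i t :=
  intervalIntegral.integral_nonneg h0 fun _ _ => hr _ _ _

/-- The clocks are continuous and nondecreasing, and a driver is constant just to the right of each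
point. This supplies the `right` hypothesis of `real_induction`. -/
theorem timeChange_exists_eq {W : Fin k → ℝ → ℕ} (hW : ∀ i, IsDriver (W i))
    {r : Fin k → ℝ → (Fin k → ℕ) → ℝ} (hr : ∀ i t a, 0 ≤ r i t a)
    {A : ℝ → Fin k → ℕ} {t : ℝ}
    (hint : ∀ i, IntervalIntegrable (fun s => r i s (A s)) volume 0 t)
    {s : ℝ} (hs : s ∈ Ico 0 t) :
    ∃ δ > 0, ∀ v ∈ Ioo s (s + δ), v ≤ t → timeChange W r A v = timeChange W r A s := by
  have key : ∀ i, ∃ δ > 0, ∀ v ∈ Ioo s (s + δ), v ≤ t →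
      timeChange W r A v i = timeChange W r A s i := by
    intro i
    obtain ⟨ε, hε, h1⟩ := (hW i).exists_eq (clock r A i s)
    have hc : ContinuousOn (fun u => clock r A i u) (uIcc 0 t) :=
      intervalIntegral.continuousOn_primitive_interval' (hint i) left_mem_uIcc
    have hs' : s ∈ uIcc 0 t := by
      rw [uIcc_of_le (hs.1.trans hs.2.le)]; exact ⟨hs.1, hs.2.le⟩
    obtain ⟨δ, hδ, h2⟩ := Metric.continuousOn_iff.1 hc s hs' ε hε
    refine ⟨δ, hδ, fun v hv hvt => h1 _ ⟨clock_mono hr (hint i) hs.1 hv.1.le hvt, ?_⟩⟩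
    have hv' : v ∈ uIcc 0 t := by
      rw [uIcc_of_le (hs.1.trans hs.2.le)]; exact ⟨hs.1.trans hv.1.le, hvt⟩
    have := h2 v hv' (by rw [Real.dist_eq, abs_lt]; constructor <;> linarith [hv.1, hv.2])
    rw [Real.dist_eq, abs_lt] at this
    linarith [this.2]
  choose δ hδ h using key
  rcases isEmpty_or_nonempty (Fin k) with hk | hk
  · exact ⟨1, one_pos, fun v _ _ => Subsingleton.elim _ _⟩
  refine ⟨Finset.univ.inf' Finset.univ_nonempty δ, by simpa using hδ, fun v hv hvt => ?_⟩
  funext i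
  exact h i v ⟨hv.1, hv.2.trans_le (by gcongr; exact Finset.inf'_le _ (Finset.mem_univ i))⟩ hvt

/-- Agreement before `s` fixes the clocks, hence the paths, at `s`; both paths then stay constant
for a while. No regularity of the rates in the state is needed. -/
theorem SolvesUpTo.eqOn {W : Fin k → ℝ → ℕ} (hW : ∀ i, IsDriver (W i))
    {r : Fin k → ℝ → (Fin k → ℕ) → ℝ} (hr : ∀ i t a, 0 ≤ r i t a) {t : ℝ}
    {A B : ℝ → Fin k → ℕ} (hA : SolvesUpTo W r t A) (hB : SolvesUpTo W r t B) :
    ∀ s ∈ Icc 0 t, A s = B s := by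
  have aux : ∀ s ∈ Icc 0 t, (∀ v ∈ Ico 0 s, A v = B v) → A s = B s := by
    intro s hs h
    rw [hA.eq s hs, hB.eq s hs]
    funext i
    exact congrArg (W i) (clock_congr hs.1 (fun i v hv => by rw [h v hv]) i)
  refine real_induction aux fun s hs h => ?_
  obtain ⟨δ, hδ, h1⟩ := timeChange_exists_eq hW hr hA.integrable hs
  obtain ⟨δ', hδ', h2⟩ := timeChange_exists_eq hW hr hB.integrable hs
  refine ⟨min δ δ', lt_min hδ hδ', fun v hv hvt => ?_⟩
  have hv0 : v ∈ Icc 0 t := ⟨hs.1.trans hv.1.le, hvt⟩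
  have hsI : s ∈ Icc 0 t := ⟨hs.1, hs.2.le⟩
  rw [hA.eq v hv0, hB.eq v hv0, h1 v ⟨hv.1, hv.2.trans_le (by gcongr; exact min_le_left _ _)⟩ hvt,
    h2 v ⟨hv.1, hv.2.trans_le (by gcongr; exact min_le_right _ _)⟩ hvt, ← hA.eq s hsI,
    ← hB.eq s hsI, h s ⟨hs.1, le_rfl⟩]

/-- The equation sees a driver only at the clock readings. With uniqueness, this makes solutions
nonanticipating. -/
theorem SolvesUpTo.congr_driver {W W' : Fin k → ℝ → ℕ} {r : Fin k → ℝ → (Fin k → ℕ) → ℝ} {t : ℝ}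
    {A : ℝ → Fin k → ℕ} (hA : SolvesUpTo W r t A)
    (h : ∀ i, ∀ s ∈ Icc 0 t, W i (clock r A i s) = W' i (clock r A i s)) :
    SolvesUpTo W' r t A :=
  ⟨hA.integrable, fun s hs => by rw [hA.eq s hs]; funext i; exact h i s hs⟩

theorem SolvesUpTo.congr_rate {W : Fin k → ℝ → ℕ} {r r' : Fin k → ℝ → (Fin k → ℕ) → ℝ} {t : ℝ}
    {A : ℝ → Fin k → ℕ} (ht : 0 ≤ t) (hA : SolvesUpTo W r t A)
    (h : ∀ i, ∀ s ∈ Icc 0 t, r i s (A s) = r' i s (A s)) :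
    SolvesUpTo W r' t A := by
  refine ⟨fun i => (intervalIntegrable_congr ?_).1 (hA.integrable i), fun s hs => ?_⟩
  · intro s hs
    rw [uIoc_of_le ht] at hs
    exact h i s ⟨hs.1.le, hs.2⟩
  · rw [hA.eq s hs]
    funext i
    exact congrArg (W i) (clock_congr hs.1 (fun i v hv => h i v ⟨hv.1, hv.2.le.trans hs.2⟩) i)

theorem SolvesUpTo.mono_time {W : Fin k → ℝ → ℕ} {r : Fin k → ℝ → (Fin k → ℕ) → ℝ} {s t : ℝ}
    {A : ℝ → Fin k → ℕ} (hs : 0 ≤ s) (hst : s ≤ t) (hA : SolvesUpTo W r t A) :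
    SolvesUpTo W r s A :=
  ⟨fun i => (hA.integrable i).mono_set (by
    rw [uIcc_of_le hs, uIcc_of_le (hs.trans hst)]; exact Icc_subset_Icc_right hst),
    fun v hv => hA.eq v ⟨hv.1, hv.2.trans hst⟩⟩

theorem SolvesUpTo.mono {W : Fin k → ℝ → ℕ} (hW : ∀ i, IsDriver (W i))
    {r : Fin k → ℝ → (Fin k → ℕ) → ℝ} (hr : ∀ i t a, 0 ≤ r i t a) {t : ℝ}
    {A : ℝ → Fin k → ℕ} (hA : SolvesUpTo W r t A) {s s' : ℝ} (h0 : 0 ≤ s) (h : s ≤ s')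
    (h' : s' ≤ t) : A s ≤ A s' := by
  rw [hA.eq s ⟨h0, h.trans h'⟩, hA.eq s' ⟨h0.trans h, h'⟩]
  exact fun i => (hW i).mono (clock_mono hr (hA.integrable i) h0 h h')

/-! ### Truncated rates and the explicit truncated solution. -/

section trunc

variable {r : Fin k → ℝ → (Fin k → ℕ) → ℝ} {R : ℝ}

theorem trunc_nonneg (hr : ∀ i t a, 0 ≤ r i t a) (m : ℕ) (i t a) : 0 ≤ trunc r m i t a := by
  unfold trunc; split_ifs; exacts [hr _ _ _, le_rfl]

theorem trunc_eq {m : ℕ} {a : Fin k → ℕ} (h : ∑ j, a j < m) (i : Fin k) (t : ℝ) :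
    trunc r m i t a = r i t a := if_pos h

theorem trunc_le_self (hr : ∀ i t a, 0 ≤ r i t a) (m : ℕ) (i t a) : trunc r m i t a ≤ r i t a := by
  unfold trunc; split_ifs; exacts [le_rfl, hr _ _ _]

theorem trunc_mono (hr : ∀ i t a, 0 ≤ r i t a) {m n : ℕ} (h : m ≤ n) (i t a) :
    trunc r m i t a ≤ trunc r n i t a := by
  unfold trunc
  split_ifs with h1 h2 h2
  exacts [le_rfl, absurd (h1.trans_le h) h2, hr _ _ _, le_rfl]

theorem IsRate.trunc_le (hr : IsRate r R) (hR : 0 ≤ R) (m : ℕ) (i t a) :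
    trunc r m i t a ≤ R * (1 + m) := by
  unfold trunc
  split_ifs with h
  · refine (hr.le i t a).trans ?_
    gcongr
    exact_mod_cast h.le
  · positivity

theorem IsRate.measurable_uncurry_trunc (hr : IsRate r R) (m : ℕ) (i : Fin k) :
    Measurable fun p : ℝ × (Fin k → ℕ) => trunc r m i p.1 p.2 := by
  refine measurable_from_prod_countable_left fun a => ?_
  by_cases h : ∑ j, a j < m
  · simpa [trunc, h] using hr.meas i a
  · simp [trunc, h]

theorem IsRate.intervalIntegrable_trunc (hr : IsRate r R) (hR : 0 ≤ R) (m : ℕ) (i : Fin k)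
    {A : ℝ → Fin k → ℕ} (hA : Measurable A) (a b : ℝ) :
    IntervalIntegrable (fun s => trunc r m i s (A s)) volume a b := by
  have hm : Measurable fun s => trunc r m i s (A s) :=
    (hr.measurable_uncurry_trunc m i).comp (measurable_id.prodMk hA)
  refine (intervalIntegrable_const (c := R * (1 + m))).mono_fun' hm.aestronglyMeasurable ?_
  refine Eventually.of_forall fun s => ?_
  dsimp only
  rw [Real.norm_of_nonneg (trunc_nonneg hr.nonneg _ _ _ _)]
  exact hr.trunc_le hR _ _ _ _

theorem IsRate.measurable_timeChange_trunc (hr : IsRate r R) (hR : 0 ≤ R) (m : ℕ)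
    {W : Fin k → ℝ → ℕ} (hW : ∀ i, IsDriver (W i)) {A : ℝ → Fin k → ℕ} (hA : Measurable A) :
    Measurable (timeChange W (trunc r m) A) := by
  refine measurable_pi_iff.2 fun i => Monotone.measurable fun s s' h => (hW i).mono ?_
  have hi := hr.intervalIntegrable_trunc hR m i hA
  have : clock (trunc r m) A i s' - clock (trunc r m) A i s =
      ∫ v in s..s', trunc r m i v (A v) :=
    intervalIntegral.integral_interval_sub_left (hi _ _) (hi _ _)
  have h2 : 0 ≤ ∫ v in s..s', trunc r m i v (A v) :=
    intervalIntegral.integral_nonneg h fun _ _ => trunc_nonneg hr.nonneg _ _ _ _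
  linarith

theorem IsRate.measurable_truncSol (hr : IsRate r R) (hR : 0 ≤ R)
    {W : Fin k → ℝ → ℕ} (hW : ∀ i, IsDriver (W i)) (m : ℕ) : Measurable (truncSol W r m) := by
  induction m with
  | zero => exact measurable_const
  | succ m ih =>
    exact hr.measurable_timeChange_trunc hR _ hW (hr.measurable_timeChange_trunc hR _ hW ih)

/-- `truncSol W r m` solves the equation with rates truncated at level `m`. -/
theorem IsRate.truncSol_eq (hr : IsRate r R) (hR : 0 ≤ R)
    {W : Fin k → ℝ → ℕ} (hW : ∀ i, IsDriver (W i)) (m : ℕ) :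
    ∀ s, 0 ≤ s → truncSol W r m s = timeChange W (trunc r m) (truncSol W r m) s := by
  induction m with
  | zero =>
    intro s _
    funext i
    simp [truncSol, timeChange, clock, trunc]
  | succ m ih =>
    -- `B` and `A'` are one and two Picard steps at level `m + 1`. `B` equals `A` while its total is
    -- at most `m`, and its first exit above `m` is already correct; afterwards `B` may run on stale
    -- states of `A`. In the second step the total of `B` exceeds `m` from then on, so the clocks
    -- stop as they should.
    set A := truncSol W r m with hA
    set B := timeChange W (trunc r (m + 1)) A with hB
    set A' := timeChange W (trunc r (m + 1)) B with hA'
    have hAm : Measurable A := hr.measurable_truncSol hR hW m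
    have hBm : Measurable B := hr.measurable_timeChange_trunc hR _ hW hAm
    have hiA := fun n i => hr.intervalIntegrable_trunc hR n i hAm
    have hiB := fun n i => hr.intervalIntegrable_trunc hR n i hBm
    have hAB : ∀ s, 0 ≤ s → A s ≤ B s := by
      intro s hs i
      rw [ih s hs]
      refine (hW i).mono (intervalIntegral.integral_mono_on hs (hiA _ _ _ _) (hiA _ _ _ _) ?_)
      exact fun v _ => trunc_mono hr.nonneg (Nat.le_succ m) _ _ _
    have hAmono : ∀ s s', 0 ≤ s → s ≤ s' → A s ≤ A s' := fun s s' h0 h => by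
      rw [ih s h0, ih s' (h0.trans h)]
      exact fun i => (hW i).mono (clock_mono (trunc_nonneg hr.nonneg m) (hiA _ _ _ _) h0 h le_rfl)
    have hBmono : ∀ s s', 0 ≤ s → s ≤ s' → B s ≤ B s' := fun s s' h0 h i =>
      (hW i).mono (clock_mono (trunc_nonneg hr.nonneg _) (hiA _ _ _ _) h0 h le_rfl)
    have hA'mono : ∀ s s', 0 ≤ s → s ≤ s' → A' s ≤ A' s' := fun s s' h0 h i =>
      (hW i).mono (clock_mono (trunc_nonneg hr.nonneg _) (hiB _ _ _ _) h0 h le_rfl)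
    have hsum : ∀ {a b : Fin k → ℕ}, a ≤ b → ∑ j, a j ≤ ∑ j, b j := fun h =>
      Finset.sum_le_sum fun j _ => h j
    -- below level `m + 1` the first Picard step does not change the path
    have h1 : ∀ s, 0 ≤ s → ∑ j, B s j ≤ m → B s = A s := by
      intro s hs hBs
      have hle := hsum (hAB s hs)
      rcases (hle.trans hBs).lt_or_eq with h | h
      · rw [ih s hs]
        funext i
        refine congrArg (W i) (clock_congr hs (fun i v hv => ?_) i)
        have := (hsum (hAmono v s hv.1 hv.2.le)).trans_lt h
        rw [trunc_eq this, trunc_eq (this.trans (Nat.lt_succ_self m))]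
      -- Since `A ≤ B` componentwise, equal totals force equality.
      · have heq : ∑ j, A s j = ∑ j, B s j := le_antisymm hle (h ▸ hBs)
        have := (Finset.sum_eq_sum_iff_of_le fun j _ => hAB s hs j).1 heq
        funext j
        exact (this j (Finset.mem_univ j)).symm
    have h2 : ∀ s, 0 ≤ s → (∀ v ∈ Ico 0 s, ∑ j, B v j ≤ m) → A' s = B s := by
      intro s hs h
      funext i
      exact congrArg (W i) (clock_congr hs (fun i v hv => by rw [h1 v hv.1 (h v hv)]) i)
    -- When `B` first exceeds `m`, nothing earlier separates `A'` from `B`, so `A'` exceeds `m` too;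
    -- monotonicity keeps it there.
    have h3 : ∀ t, 0 ≤ t → ∀ s ∈ Icc 0 t, ∑ j, B s j ≤ m ∨ m < ∑ j, A' s j := by
      intro t ht
      refine real_induction (fun s hs h => ?_) (fun s hs h => ?_)
      · by_cases hex : ∃ v ∈ Ico 0 s, m < ∑ j, A' v j
        · obtain ⟨v, hv, hv2⟩ := hex
          exact Or.inr (hv2.trans_le (hsum (hA'mono v s hv.1 hv.2.le)))
        · push Not at hex
          rw [h2 s hs.1 fun v hv => (h v hv).resolve_right (not_lt.2 (hex v hv))]
          exact le_or_gt _ _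
      · rcases h s ⟨hs.1, le_rfl⟩ with h' | h'
        · obtain ⟨δ, hδ, h4⟩ := timeChange_exists_eq hW (trunc_nonneg hr.nonneg (m + 1))
            (fun i => hiA (m + 1) i 0 t) hs
          exact ⟨δ, hδ, fun v hv hvt => Or.inl (by rw [hB, h4 v hv hvt]; exact h')⟩
        · exact ⟨1, one_pos, fun v hv _ =>
            Or.inr (h'.trans_le (hsum (hA'mono s v hs.1 hv.1.le)))⟩
    intro s hs
    change A' s = timeChange W (trunc r (m + 1)) A' s
    funext i
    refine congrArg (W i) (clock_congr hs (fun i v hv => ?_) i)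
    -- Either `A' = B` at `v`, or both totals exceed `m` and both truncated rates vanish.
    rcases h3 v hv.1 v ⟨hv.1, le_rfl⟩ with h | h
    · rw [h2 v hv.1 fun u hu => (hsum (hBmono u v hu.1 hu.2.le)).trans h]
    · have h' : m < ∑ j, B v j := by
        by_contra hcon
        push Not at hcon
        have := h2 v hv.1 fun u hu => (hsum (hBmono u v hu.1 hu.2.le)).trans hcon
        rw [this] at h
        exact absurd hcon (not_le.2 h)
      simp only [trunc]
      rw [if_neg (by omega), if_neg (by omega)]

theorem IsRate.solvesUpTo_truncSol (hr : IsRate r R) (hR : 0 ≤ R)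
    {W : Fin k → ℝ → ℕ} (hW : ∀ i, IsDriver (W i)) (m : ℕ) (t : ℝ) :
    SolvesUpTo W (trunc r m) t (truncSol W r m) :=
  ⟨fun i => hr.intervalIntegrable_trunc hR m i (hr.measurable_truncSol hR hW m) _ _,
    fun s hs => hr.truncSol_eq hR hW m s hs.1⟩

/-- As long as its total count is below `m`, a solution is `truncSol W r m`. -/
theorem IsRate.eq_truncSol (hr : IsRate r R) (hR : 0 ≤ R)
    {W : Fin k → ℝ → ℕ} (hW : ∀ i, IsDriver (W i)) {m : ℕ} {t : ℝ} (ht : 0 ≤ t)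
    {A : ℝ → Fin k → ℕ} (hA : SolvesUpTo W r t A) (hm : ∑ j, A t j < m) :
    ∀ s ∈ Icc 0 t, A s = truncSol W r m s := by
  refine (hA.congr_rate ht fun i s hs => ?_).eqOn hW (trunc_nonneg hr.nonneg m)
    (hr.solvesUpTo_truncSol hR hW m t)
  refine (trunc_eq ?_ i s).symm
  exact (Finset.sum_le_sum fun j _ => hA.mono hW hr.nonneg hs.1 hs.2 le_rfl j).trans_lt hm

/-- The truncated solution only depends on the driving paths up to the current clocks. -/
theorem IsRate.truncSol_congr (hr : IsRate r R) (hR : 0 ≤ R)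
    {W W' : Fin k → ℝ → ℕ} (hW : ∀ i, IsDriver (W i)) (hW' : ∀ i, IsDriver (W' i)) {m : ℕ} {t : ℝ}
    (h : ∀ i, ∀ v ∈ Icc 0 (clock (trunc r m) (truncSol W r m) i t), W i v = W' i v) :
    ∀ s ∈ Icc 0 t, truncSol W r m s = truncSol W' r m s := by
  have hs := hr.solvesUpTo_truncSol hR hW m t
  refine (hs.congr_driver fun i s hst => h i _ ⟨?_, ?_⟩).eqOn hW' (trunc_nonneg hr.nonneg m)
    (hr.solvesUpTo_truncSol hR hW' m t)
  · exact clock_nonneg (trunc_nonneg hr.nonneg m) _ _ hst.1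
  · exact clock_mono (trunc_nonneg hr.nonneg m) (hs.integrable i) hst.1 hst.2 le_rfl

end trunc

end AdjustedFluid

namespace AdjustedFluid

/-! ### Joint measurability in time and randomness. -/

section measurability

variable {k : ℕ} {Ω : Type*} [MeasurableSpace Ω]

/-- By monotonicity and right-continuity, `n ≤ w v` holds iff `n ≤ w q` for every rational `q > v`:
a countable intersection. -/
theorem measurable_driver_uncurry {w : ℝ → Ω → ℕ} (hd : ∀ ω, IsDriver fun v => w v ω)
    (hm : ∀ v, Measurable (w v)) : Measurable fun p : ℝ × Ω => w p.1 p.2 := by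
  refine measurable_of_Ici fun n => ?_
  have : (fun p : ℝ × Ω => w p.1 p.2) ⁻¹' Ici n =
      ⋂ q : ℚ, ({p : ℝ × Ω | (q : ℝ) ≤ p.1} ∪ {p : ℝ × Ω | n ≤ w q p.2}) := by
    ext ⟨v, ω⟩
    simp only [mem_preimage, mem_Ici, mem_iInter, mem_union, mem_ofPred_eq]
    constructor
    · intro h q
      rcases le_or_gt (q : ℝ) v with hq | hq
      · exact Or.inl hq
      · exact Or.inr (h.trans ((hd ω).mono hq.le))
    · intro h
      obtain ⟨δ, hδ, h1⟩ := (hd ω).exists_eq v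
      obtain ⟨q, hq, hq2⟩ := exists_rat_btwn (show v < v + δ by linarith)
      have := (h q).resolve_left (not_le.2 hq)
      rwa [h1 q ⟨hq.le, hq2⟩] at this
  rw [this]
  refine MeasurableSet.iInter fun q => (measurableSet_le measurable_const measurable_fst).union ?_
  exact ((hm q).comp measurable_snd) measurableSet_Ici

theorem measurable_intervalIntegral_uncurry {h : ℝ × Ω → ℝ} (hh : Measurable h) :
    Measurable fun p : ℝ × Ω => ∫ s in (0 : ℝ)..p.1, h (s, p.2) := by
  have key : ∀ S : Set ((ℝ × Ω) × ℝ), MeasurableSet S →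
      Measurable fun p : ℝ × Ω => ∫ s, S.indicator (fun q => h (q.2, q.1.2)) (p, s) := by
    intro S hS
    have : Measurable fun q : (ℝ × Ω) × ℝ => h (q.2, q.1.2) := by fun_prop
    exact (this.indicator hS).stronglyMeasurable.integral_prod_right'.measurable
  have h1 := key {q | 0 < q.2 ∧ q.2 ≤ q.1.1}
    ((measurableSet_lt measurable_const measurable_snd).inter
      (measurableSet_le measurable_snd (by fun_prop)))
  have h2 := key {q | q.1.1 < q.2 ∧ q.2 ≤ 0}
    ((measurableSet_lt (by fun_prop) measurable_snd).inter
      (measurableSet_le measurable_snd (by fun_prop)))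
  convert! h1.sub h2 using 1
  funext p
  simp only [Pi.sub_apply, intervalIntegral]
  rw [← integral_indicator measurableSet_Ioc, ← integral_indicator measurableSet_Ioc]
  rfl

variable {r : Fin k → ℝ → (Fin k → ℕ) → ℝ} {R : ℝ}

theorem IsRate.measurable_clock_uncurry (hr : IsRate r R) {A : Ω → ℝ → Fin k → ℕ}
    (hA : Measurable fun p : ℝ × Ω => A p.2 p.1) (m : ℕ) (i : Fin k) :
    Measurable fun p : ℝ × Ω => clock (trunc r m) (A p.2) i p.1 :=
  measurable_intervalIntegral_uncurry (h := fun p => trunc r m i p.1 (A p.2 p.1))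
    ((hr.measurable_uncurry_trunc m i).comp (measurable_fst.prodMk hA))

theorem IsRate.measurable_timeChange_uncurry (hr : IsRate r R) {W : Ω → Fin k → ℝ → ℕ}
    (hW : ∀ ω i, IsDriver (W ω i)) (hm : ∀ i v, Measurable fun ω => W ω i v)
    {A : Ω → ℝ → Fin k → ℕ} (hA : Measurable fun p : ℝ × Ω => A p.2 p.1) (m : ℕ) :
    Measurable fun p : ℝ × Ω => timeChange (W p.2) (trunc r m) (A p.2) p.1 := by
  refine measurable_pi_iff.2 fun i => ?_
  exact (measurable_driver_uncurry (w := fun v ω => W ω i v) (fun ω => hW ω i) (hm i)).comp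
    ((hr.measurable_clock_uncurry hA m i).prodMk measurable_snd)

theorem IsRate.measurable_truncSol_uncurry (hr : IsRate r R) {W : Ω → Fin k → ℝ → ℕ}
    (hW : ∀ ω i, IsDriver (W ω i)) (hm : ∀ i v, Measurable fun ω => W ω i v) (m : ℕ) :
    Measurable fun p : ℝ × Ω => truncSol (W p.2) r m p.1 := by
  induction m with
  | zero => exact measurable_pi_iff.2 fun i => (hm i 0).comp measurable_snd
  | succ m ih =>
    exact hr.measurable_timeChange_uncurry hW hm
      (A := fun ω => timeChange (W ω) (trunc r (m + 1)) (truncSol (W ω) r m))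
      (hr.measurable_timeChange_uncurry hW hm (A := fun ω => truncSol (W ω) r m) ih _) _

end measurability

/-! ### Optional stopping for Poisson processes. -/

section poisson

theorem lintegral_poissonMeasure (c : ℝ≥0) : ∫⁻ n : ℕ, (n : ENNReal) ∂(poissonMeasure c) = c := by
  have hs : HasSum (fun n : ℕ => Real.exp (-c) * (c : ℝ) ^ n / (n.factorial : ℝ) * n) c := by
    rw [← hasSum_nat_add_iff' 1]
    have := (hasSum_one_poissonMeasure c).mul_left (c : ℝ)
    convert! this using 1
    · funext n
      rw [Nat.factorial_succ, pow_succ]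
      push_cast
      field_simp
    · simp
  rw [poissonMeasure, lintegral_sum_measure]
  simp only [lintegral_smul_measure, lintegral_dirac, smul_eq_mul]
  have : ∀ n : ℕ, ENNReal.ofReal (Real.exp (-c) * (c : ℝ) ^ n / (n.factorial : ℝ)) * (n : ENNReal) =
      ENNReal.ofReal (Real.exp (-c) * (c : ℝ) ^ n / (n.factorial : ℝ) * n) := fun n => by
    rw [ENNReal.ofReal_mul (by positivity), ENNReal.ofReal_natCast]
  simp_rw [this]
  rw [← ENNReal.ofReal_tsum_of_nonneg (fun n => by positivity) hs.summable, hs.tsum_eq,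
    ENNReal.ofReal_coe_nnreal]

variable {Ω : Type*} [mΩ : MeasurableSpace Ω] {P : Measure Ω}

theorem IsUnitPoissonProcess.lintegral_sub {Y : ℝ≥0 → Ω → ℕ} (hY : IsUnitPoissonProcess P Y)
    {s t : ℝ≥0} (h : s ≤ t) : ∫⁻ ω, ((Y t ω - Y s ω : ℕ) : ENNReal) ∂P = (t - s : ℝ≥0) := by
  rw [← lintegral_poissonMeasure, ← (hY.increments s t h).map_eq,
    lintegral_map' (by fun_prop) (hY.increments s t h).aemeasurable]

/-- It suffices to treat finitely many times. The values there are sums of increments over a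
partition of `[0, a]`, which are independent of the increment over `(a, b]`. -/
theorem IsUnitPoissonProcess.indepFun_past [IsProbabilityMeasure P] {Y : ℝ≥0 → Ω → ℕ}
    (hY : IsUnitPoissonProcess P Y) {a b : ℝ≥0} (h : a ≤ b) :
    IndepFun (fun ω (v : ℝ≥0) => Y (min v a) ω) (fun ω => Y b ω - Y a ω) P := by
  refine IndepFun.process_indepFun (fun v => hY.measurable _)
    ((hY.measurable b).sub (hY.measurable a)) fun I => ?_
  classical
  set S : Finset ℝ≥0 := insert 0 (insert a (I.image fun v => min v a)) with hS
  have hSa : ∀ v ∈ S, v ≤ a := by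
    intro v hv
    simp only [hS, Finset.mem_insert, Finset.mem_image] at hv
    rcases hv with rfl | rfl | ⟨w, -, rfl⟩
    exacts [zero_le, le_rfl, min_le_right _ _]
  have h0S : (0 : ℝ≥0) ∈ S := by simp [hS]
  have haS : a ∈ S := by simp [hS]
  obtain ⟨n, hn⟩ : ∃ n, S.card = n + 1 :=
    Nat.exists_eq_succ_of_ne_zero (Finset.card_ne_zero_of_mem h0S)
  set f := S.orderEmbOfFin hn with hf
  -- The points of `S` in increasing order, then `b` forever; the increment of index `n` is the one
  -- over `(a, b]`.
  set t : ℕ → ℝ≥0 := fun j => if hj : j < n + 1 then f ⟨j, hj⟩ else b with ht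
  have hfS : ∀ j, f j ∈ S := fun j => Finset.orderEmbOfFin_mem S hn j
  have htmono : Monotone t := by
    intro i j hij
    simp only [ht]
    split_ifs with h1 h2 h2
    · exact f.monotone (by simpa using hij)
    · exact (hSa _ (hfS _)).trans h
    · omega
    · exact le_rfl
  have htsurj : ∀ v ∈ S, ∃ j, j < n + 1 ∧ t j = v := by
    intro v hv
    have : v ∈ Set.range f := by rw [hf, Finset.range_orderEmbOfFin]; exact hv
    obtain ⟨j, hj⟩ := this
    exact ⟨j, j.2, by simp only [ht, j.2, dif_pos]; exact hj⟩
  have ht0 : t 0 = 0 := by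
    obtain ⟨j, -, hj⟩ := htsurj 0 h0S
    exact le_antisymm (hj ▸ htmono (Nat.zero_le j)) zero_le
  have htn : t n = a := by
    obtain ⟨j, hj, hj2⟩ := htsurj a haS
    refine le_antisymm ?_ (hj2 ▸ htmono (Nat.lt_succ_iff.1 hj))
    simp only [ht, Nat.lt_succ_self, dif_pos]
    exact hSa _ (hfS _)
  have htn1 : t (n + 1) = b := by simp [ht]
  have hind := hY.indepIncrements.nat htmono
  have hind2 := hind.indepFun_finset (Finset.range n) {n} (by simp)
    fun i => (hY.measurable _).sub (hY.measurable _)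
  have hidx : ∀ v : I, ∃ j, j < n + 1 ∧ t j = min v.1 a := fun v =>
    htsurj _ (by simp only [hS, Finset.mem_insert, Finset.mem_image]
                 exact Or.inr (Or.inr ⟨v, v.2, rfl⟩))
  choose idx hidx1 hidx2 using hidx
  have hind3 := hind2.comp
    (φ := fun (D : Finset.range n → ℕ) (v : I) =>
      ∑ i : Finset.range n, if i.1 < idx v then D i else 0)
    (ψ := fun (D : ({n} : Finset ℕ) → ℕ) => D ⟨n, by simp⟩)
    (measurable_of_countable _ ) (measurable_of_countable _)
  refine hind3.congr ?_ ?_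
  · filter_upwards [hY.zero, hY.monotone] with ω hz hm
    funext v
    simp only [Function.comp]
    rw [Finset.sum_coe_sort (Finset.range n)
      (fun i => if i < idx v then Y (t (i + 1)) ω - Y (t i) ω else 0), ← Finset.sum_filter]
    have : (Finset.range n).filter (· < idx v) = Finset.range (idx v) := by
      ext i
      simp only [Finset.mem_filter, Finset.mem_range]
      have := hidx1 v
      omega
    rw [this, Finset.sum_range_tsub (f := fun i => Y (t i) ω) (hm.comp htmono), hidx2, ht0, hz]
    simp
  · filter_upwards with ω
    simp [htn, htn1]

/-- The joint law is a triple product, regrouped by associativity. -/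
theorem indepFun_prodMk_of_indepFun [IsProbabilityMeasure P] {α β γ : Type*} [MeasurableSpace α]
    [MeasurableSpace β] [MeasurableSpace γ] {X : Ω → α} {Y : Ω → β} {Z : Ω → γ}
    (hX : Measurable X) (hY : Measurable Y) (hZ : Measurable Z) (h1 : IndepFun X Y P)
    (h2 : IndepFun (fun ω => (X ω, Y ω)) Z P) : IndepFun X (fun ω => (Y ω, Z ω)) P := by
  have h3 : IndepFun Y Z P := h2.comp (φ := Prod.snd) (ψ := id) measurable_snd measurable_id
  rw [indepFun_iff_map_prod_eq_prod_map_map (by fun_prop) (by fun_prop)] at h1 h2 h3 ⊢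
  have := Measure.isProbabilityMeasure_map (μ := P) hX.aemeasurable
  have := Measure.isProbabilityMeasure_map (μ := P) hY.aemeasurable
  have := Measure.isProbabilityMeasure_map (μ := P) hZ.aemeasurable
  rw [h3, ← Measure.prodAssoc_prod, ← h1, ← h2, Measure.map_map (by fun_prop) (by fun_prop)]
  rfl

/-- The clock of `Y i` depends on all the processes, so the information at `a` must contain the
whole paths of the others besides the past of `Y i`. -/
theorem indepFun_stopped [IsProbabilityMeasure P] {k : ℕ} {Y : Fin k → ℝ≥0 → Ω → ℕ}
    (hY : ∀ i, IsUnitPoissonProcess P (Y i)) (hind : iIndepFun (fun i ω t => Y i t ω) P)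
    (i : Fin k) {a b : ℝ≥0} (h : a ≤ b) :
    IndepFun (fun ω => Y i b ω - Y i a ω)
      (fun ω j (v : ℝ≥0) => Y j (if j = i then min v a else v) ω) P := by
  classical
  have hm : ∀ j, Measurable fun ω t => Y j t ω := fun j => measurable_pi_iff.2 (hY j).measurable
  have h1 := hind.indepFun_finset {i} {i}ᶜ disjoint_compl_right hm
  have h2 : IndepFun (fun ω => (Y i b ω - Y i a ω, fun v : ℝ≥0 => Y i (min v a) ω))
      (fun ω (j : ({i}ᶜ : Finset (Fin k))) t => Y j t ω) P :=
    h1.comp (φ := fun y : ({i} : Finset (Fin k)) → ℝ≥0 → ℕ => (y ⟨i, by simp⟩ b - y ⟨i, by simp⟩ a,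
      fun v : ℝ≥0 => y ⟨i, by simp⟩ (min v a))) (ψ := id)
      (by
        refine Measurable.prodMk ?_ (measurable_pi_iff.2 fun v => ?_)
        · have hc : ∀ c : ℝ≥0, Measurable fun y : ({i} : Finset (Fin k)) → ℝ≥0 → ℕ =>
              y ⟨i, by simp⟩ c := fun c => (measurable_pi_apply c).comp (measurable_pi_apply _)
          exact (hc b).sub (hc a)
        · exact (measurable_pi_apply _).comp (measurable_pi_apply _)) measurable_id
  have h3 := indepFun_prodMk_of_indepFun (X := fun ω => Y i b ω - Y i a ω)
    (Z := fun ω (j : ({i}ᶜ : Finset (Fin k))) t => Y j t ω) (((hY i).measurable b).sub ((hY i).measurable a))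
    (measurable_pi_iff.2 fun v => (hY i).measurable _)
    (measurable_pi_iff.2 fun j => hm j.1) ((hY i).indepFun_past h).symm h2
  have h4 := h3.comp (φ := id)
    (ψ := fun (p : (ℝ≥0 → ℕ) × (({i}ᶜ : Finset (Fin k)) → ℝ≥0 → ℕ)) (j : Fin k) (v : ℝ≥0) =>
      if hj : j = i then p.1 v else p.2 ⟨j, by simpa using hj⟩ v) measurable_id
    (by
      refine measurable_pi_iff.2 fun j => measurable_pi_iff.2 fun v => ?_
      split_ifs with hj
      · exact (measurable_pi_apply v).comp measurable_fst
      · exact (measurable_pi_apply v).comp ((measurable_pi_apply _).comp measurable_snd))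
  refine h4.congr (Eventually.of_forall fun ω => rfl) (Eventually.of_forall fun ω => ?_)
  funext j v
  simp only [Function.comp]
  split_ifs with hj
  · rw [hj]
  · rfl

/-- With `θ` rounded up to the grid, `Y` is the sum over `j` of its increments over `(jh, (j+1)h]`
times the indicator of `jh ≤ θ`. That event is, up to a null set, the complement of a set in `G
(jh)`, hence independent of the increment, whose mean is `h`. All terms are nonnegative, so no
integrability is needed. -/
theorem IsUnitPoissonProcess.lintegral_grid [IsProbabilityMeasure P] {Y : ℝ≥0 → Ω → ℕ}
    (hY : IsUnitPoissonProcess P Y) {G : ℝ≥0 → MeasurableSpace Ω} (hG : ∀ u, G u ≤ mΩ)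
    (hind : ∀ a b, a ≤ b →
      Indep (MeasurableSpace.comap (fun ω => Y b ω - Y a ω) ⊤) (G a) P)
    {θ : Ω → ℝ≥0} (hθ : ∀ u, ∃ S, MeasurableSet[G u] S ∧ {ω | θ ω < u} =ᵐ[P] S)
    {h : ℝ≥0} (hh : 0 < h) :
    AEMeasurable (fun ω => (Y ((⌊θ ω / h⌋₊ + 1) * h) ω : ENNReal)) P ∧
    ∫⁻ ω, (Y ((⌊θ ω / h⌋₊ + 1) * h) ω : ENNReal) ∂P =
      ∫⁻ ω, (((⌊θ ω / h⌋₊ + 1) * h : ℝ≥0) : ENNReal) ∂P := by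
  choose S hS hS2 using hθ
  set s : ℕ → Set Ω := fun j => (S ((j : ℝ≥0) * h))ᶜ with hs
  have hsm : ∀ j : ℕ, MeasurableSet[G ((j : ℝ≥0) * h)] (s j) := fun j => (hS _).compl
  have hsm' : ∀ j, MeasurableSet (s j) := fun j => hG _ _ (hsm j)
  have hmem : ∀ᵐ ω ∂P, ∀ j : ℕ, ω ∈ s j ↔ j < ⌊θ ω / h⌋₊ + 1 := by
    refine ae_all_iff.2 fun j : ℕ => ?_
    filter_upwards [hS2 (j * h)] with ω hω
    have hω' : θ ω < j * h ↔ ω ∈ S (j * h) := iff_of_eq hω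
    rw [hs, mem_compl_iff, ← hω', not_lt, Nat.lt_succ_iff, Nat.le_floor_iff (by positivity),
      le_div_iff₀ hh]
  have hYm : ∀ j : ℕ, Measurable fun ω =>
      ((Y ((j + 1 : ℕ) * h) ω - Y (j * h) ω : ℕ) : ENNReal) := fun j =>
    (measurable_of_countable _).comp ((hY.measurable _).sub (hY.measurable _))
  have e1 : (fun ω => (Y ((⌊θ ω / h⌋₊ + 1) * h) ω : ENNReal)) =ᵐ[P] fun ω =>
      ∑' j : ℕ, ((Y ((j + 1 : ℕ) * h) ω - Y (j * h) ω : ℕ) : ENNReal) *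
        (s j).indicator (fun _ => 1) ω := by
    filter_upwards [hmem, hY.zero, hY.monotone] with ω hω h0 hmono
    rw [tsum_eq_sum (s := Finset.range (⌊θ ω / h⌋₊ + 1))]
    · rw [Finset.sum_congr rfl (g := fun j : ℕ =>
        ((Y ((j + 1 : ℕ) * h) ω - Y (j * h) ω : ℕ) : ENNReal))]
      · rw [← Nat.cast_sum, Finset.sum_range_tsub (f := fun j : ℕ => Y (j * h) ω)]
        · simp [h0]
        · exact fun i j hij => hmono (by gcongr)
      · intro j hj
        rw [indicator_of_mem ((hω j).2 (Finset.mem_range.1 hj)), mul_one]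
    · intro j hj
      rw [indicator_of_notMem (fun hc => hj (Finset.mem_range.2 ((hω j).1 hc))), mul_zero]
  have e2 : (fun ω => (((⌊θ ω / h⌋₊ + 1) * h : ℝ≥0) : ENNReal)) =ᵐ[P] fun ω =>
      ∑' j : ℕ, (h : ENNReal) * (s j).indicator (fun _ => 1) ω := by
    filter_upwards [hmem] with ω hω
    rw [tsum_eq_sum (s := Finset.range (⌊θ ω / h⌋₊ + 1))]
    · rw [Finset.sum_congr rfl (g := fun j : ℕ => (h : ENNReal))]
      · simp
      · intro j hj
        rw [indicator_of_mem ((hω j).2 (Finset.mem_range.1 hj)), mul_one]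
    · intro j hj
      rw [indicator_of_notMem (fun hc => hj (Finset.mem_range.2 ((hω j).1 hc))), mul_zero]
  have hYs : ∀ j : ℕ, Measurable fun ω => ((Y ((j + 1 : ℕ) * h) ω - Y (j * h) ω : ℕ) : ENNReal) *
      (s j).indicator (fun _ => 1) ω := fun j =>
    (hYm j).mul (measurable_const.indicator (hsm' j))
  have hsi : ∀ j, Measurable ((s j).indicator fun _ => (1 : ENNReal)) := fun j =>
    measurable_const.indicator (hsm' j)
  refine ⟨AEMeasurable.congr (Measurable.aemeasurable ?_) e1.symm, ?_⟩
  · exact Measurable.tsum hYs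
  rw [lintegral_congr_ae e1, lintegral_congr_ae e2,
    lintegral_tsum fun j => (hYs j).aemeasurable,
    lintegral_tsum fun j => ((hsi j).const_mul _).aemeasurable]
  refine tsum_congr fun j => ?_
  have hle : (j : ℝ≥0) * h ≤ (j + 1 : ℕ) * h := by gcongr; simp
  rw [lintegral_const_mul _ (hsi j), lintegral_mul_eq_lintegral_mul_lintegral_of_independent_measurableSpace
    (Mf := MeasurableSpace.comap (fun ω => Y ((j + 1 : ℕ) * h) ω - Y (j * h) ω) ⊤)
    (Mg := G (j * h))
    (((hY.measurable _).sub (hY.measurable _)).comap_le) (hG _) (hind _ _ hle), hY.lintegral_sub hle]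
  · congr 2
    rw [← tsub_mul]
    simp
  · exact (measurable_of_countable (fun n : ℕ => (n : ENNReal))).comp (comap_measurable _)
  · exact measurable_const.indicator (hsm j)

/-- Optional stopping: a random time `θ` such that `{θ < u}` is, for every `u`, independent of the
increments of the process after `u`, satisfies `E[Y(θ)] = E[θ]`. -/
theorem IsUnitPoissonProcess.lintegral_stopped [IsProbabilityMeasure P] {Y : ℝ≥0 → Ω → ℕ}
    (hY : IsUnitPoissonProcess P Y) {G : ℝ≥0 → MeasurableSpace Ω} (hG : ∀ u, G u ≤ mΩ)
    (hind : ∀ a b, a ≤ b →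
      Indep (MeasurableSpace.comap (fun ω => Y b ω - Y a ω) ⊤) (G a) P)
    {θ : Ω → ℝ≥0} (hθ : ∀ u, ∃ S, MeasurableSet[G u] S ∧ {ω | θ ω < u} =ᵐ[P] S)
    (hθm : AEMeasurable θ P) (hfin : ∫⁻ ω, (θ ω : ENNReal) ∂P ≠ ⊤) :
    ∫⁻ ω, (Y (θ ω) ω : ENNReal) ∂P = ∫⁻ ω, (θ ω : ENNReal) ∂P := by
  -- Dyadic approximations from above, as right-continuity requires; `Y (η 0)` dominates, and its
  -- mean is known from the grid case.
  set η : ℕ → Ω → ℝ≥0 := fun n ω => (⌊θ ω / (1 / 2 ^ n)⌋₊ + 1) * (1 / 2 ^ n) with hη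
  have hpos : ∀ n : ℕ, (0 : ℝ≥0) < 1 / 2 ^ n := fun n => by positivity
  have hgrid := fun n => hY.lintegral_grid hG hind hθ (hpos n)
  have hle : ∀ n ω, θ ω ≤ η n ω := fun n ω => by
    rw [hη]
    have := (Nat.lt_floor_add_one (θ ω / (1 / 2 ^ n))).le
    rwa [div_le_iff₀ (hpos n)] at this
  have hle' : ∀ n ω, η n ω ≤ θ ω + 1 / 2 ^ n := fun n ω => by
    have h1 : ((⌊θ ω / (1 / 2 ^ n)⌋₊ : ℕ) : ℝ≥0) ≤ θ ω / (1 / 2 ^ n) := Nat.floor_le zero_le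
    rw [le_div_iff₀ (hpos n)] at h1
    simp only [hη, add_mul, one_mul]
    gcongr
  -- `η 0` is an integer above `θ`, hence a multiple of `2⁻ⁿ` above `θ`; `η n` is the least such
  -- multiple.
  have hle0 : ∀ n ω, η n ω ≤ η 0 ω := fun n ω => by
    simp only [hη, pow_zero, div_one, mul_one]
    rw [mul_one_div, div_le_iff₀ (by positivity)]
    have h1 : ⌊θ ω * 2 ^ n⌋₊ < (⌊θ ω⌋₊ + 1) * 2 ^ n := by
      rw [Nat.floor_lt zero_le]
      push_cast
      gcongr
      exact Nat.lt_floor_add_one _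
    rw [div_div_eq_mul_div, div_one]
    exact_mod_cast h1
  have hpow : Tendsto (fun n : ℕ => (1 / 2 ^ n : ℝ≥0)) atTop (𝓝 0) := by
    have := NNReal.tendsto_pow_atTop_nhds_zero_of_lt_one (r := 1 / 2) (by
      rw [div_lt_one (by norm_num)]; norm_num)
    simpa [one_div, inv_pow] using this
  have hηlim : ∀ ω, Tendsto (fun n => η n ω) atTop (𝓝 (θ ω)) := fun ω => by
    refine tendsto_of_tendsto_of_tendsto_of_le_of_le tendsto_const_nhds ?_ (fun n => hle n ω)
      (fun n => hle' n ω)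
    simpa using hpow.const_add (θ ω)
  have hfin0 : ∫⁻ ω, (η 0 ω : ENNReal) ∂P ≠ ⊤ := by
    refine ne_top_of_le_ne_top (b := ∫⁻ ω, ((θ ω : ENNReal) + 1) ∂P) ?_
      (lintegral_mono fun ω => ?_)
    · rw [lintegral_add_right _ measurable_const]
      simp [hfin]
    · have := hle' 0 ω
      simp only [pow_zero, div_one] at this
      rw [← ENNReal.coe_one, ← ENNReal.coe_add]
      exact ENNReal.coe_le_coe.2 this
  have lim1 : Tendsto (fun n => ∫⁻ ω, (Y (η n ω) ω : ENNReal) ∂P) atTop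
      (𝓝 (∫⁻ ω, (Y (θ ω) ω : ENNReal) ∂P)) := by
    refine tendsto_lintegral_of_dominated_convergence' (fun ω => (Y (η 0 ω) ω : ENNReal))
      (fun n => (hgrid n).1) (fun n => ?_) ?_ ?_
    · filter_upwards [hY.monotone] with ω hm
      exact_mod_cast hm (hle0 n ω)
    · rw [show (∫⁻ ω, (Y (η 0 ω) ω : ENNReal) ∂P) = _ from (hgrid 0).2]
      exact hfin0
    · filter_upwards [hY.rightCont] with ω hr
      have h1 : Tendsto (fun n => η n ω) atTop (𝓝[≥] (θ ω)) :=
        tendsto_nhdsWithin_iff.2 ⟨hηlim ω, Eventually.of_forall fun n => hle n ω⟩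
      have h2 := (hr (θ ω)).tendsto.comp h1
      exact ((continuous_of_discreteTopology (f := fun n : ℕ => (n : ENNReal))).tendsto _).comp h2
  have hηm : ∀ n, AEMeasurable (η n) P := fun n => by
    have : Measurable fun x : ℝ≥0 => ((⌊x / (1 / 2 ^ n)⌋₊ : ℝ≥0) + 1) * (1 / 2 ^ n) := by
      fun_prop
    exact this.comp_aemeasurable hθm
  have lim2 : Tendsto (fun n => ∫⁻ ω, (η n ω : ENNReal) ∂P) atTop
      (𝓝 (∫⁻ ω, (θ ω : ENNReal) ∂P)) := by
    refine tendsto_lintegral_of_dominated_convergence' (fun ω => (η 0 ω : ENNReal))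
      (fun n => (hηm n).coe_nnreal_ennreal) (fun n => ?_) hfin0 ?_
    · exact Eventually.of_forall fun ω => ENNReal.coe_le_coe.2 (hle0 n ω)
    · exact Eventually.of_forall fun ω => ENNReal.tendsto_coe.2 (hηlim ω)
  refine tendsto_nhds_unique lim1 (lim2.congr fun n => ((hgrid n).2).symm)

end poisson

end AdjustedFluid

/-! ### Grönwall's inequality and mean counts of the truncated solution. -/

namespace AdjustedFluid

/-- Grönwall's inequality in integral form, for a bounded function and with a crude constant. -/
theorem le_of_le_add_mul_integral {φ : ℝ → ℝ} {a b B T : ℝ} (ha : 0 ≤ a) (hb : 0 ≤ b)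
    (hφ : IntervalIntegrable φ volume 0 T) (hB : ∀ t ∈ Icc 0 T, φ t ≤ B)
    (h : ∀ t ∈ Icc 0 T, φ t ≤ a + b * ∫ s in (0 : ℝ)..t, φ s) :
    ∀ t ∈ Icc 0 T, φ t ≤ 2 * a * Real.exp (2 * b * T) := by
  have hexp : ∀ t, b * ∫ s in (0 : ℝ)..t, Real.exp (2 * b * s) = (Real.exp (2 * b * t) - 1) / 2 := by
    intro t
    rw [← intervalIntegral.integral_const_mul]
    have := intervalIntegral.integral_eq_sub_of_hasDerivAt (a := 0) (b := t)
      (f := fun s => Real.exp (2 * b * s) / 2) (f' := fun s => b * Real.exp (2 * b * s))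
      (fun s _ => by
        have h1 := (((hasDerivAt_id s).const_mul (2 * b)).exp).div_const 2
        convert! h1 using 1
        simp only [id]
        ring)
      ((by fun_prop : Continuous fun s => b * Real.exp (2 * b * s)).intervalIntegrable _ _)
    rw [this]
    simp
    ring
  -- Relative to the weight `exp (2 b t)`, the operator `b ∫` contracts by `1/2`, so the a priori
  -- bound is halved at each iteration.
  have key : ∀ n : ℕ, ∀ t ∈ Icc 0 T,
      φ t ≤ (2 * a + max B 0 * (1 / 2) ^ n) * Real.exp (2 * b * t) := by
    intro n
    induction n with
    | zero =>
      intro t ht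
      have h1 : 1 ≤ Real.exp (2 * b * t) := Real.one_le_exp (by have := ht.1; positivity)
      calc φ t ≤ max B 0 * 1 := by rw [mul_one]; exact (hB t ht).trans (le_max_left _ _)
        _ ≤ (2 * a + max B 0 * (1 / 2) ^ 0) * Real.exp (2 * b * t) := by
          gcongr
          rw [pow_zero, mul_one]; linarith
    | succ n ih =>
      intro t ht
      set c := 2 * a + max B 0 * (1 / 2) ^ n with hc
      have h1 : ∫ s in (0 : ℝ)..t, φ s ≤ ∫ s in (0 : ℝ)..t, c * Real.exp (2 * b * s) := by
        refine intervalIntegral.integral_mono_on ht.1 ?_ ?_ fun s hs => ih s ⟨hs.1, hs.2.trans ht.2⟩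
        · exact hφ.mono_set (by
            rw [uIcc_of_le ht.1, uIcc_of_le (ht.1.trans ht.2)]; exact Icc_subset_Icc_right ht.2)
        · exact (by fun_prop : Continuous fun s => c * Real.exp (2 * b * s)).intervalIntegrable _ _
      have h2 := h t ht
      have h3 := mul_le_mul_of_nonneg_left h1 hb
      rw [intervalIntegral.integral_const_mul, mul_left_comm, hexp] at h3
      have h4 : 0 ≤ max B 0 * (1 / 2) ^ n := by positivity
      have : φ t ≤ a + c * ((Real.exp (2 * b * t) - 1) / 2) := by linarith
      refine this.trans ?_
      rw [pow_succ]
      have : c * ((Real.exp (2 * b * t) - 1) / 2) = c / 2 * Real.exp (2 * b * t) - c / 2 := by ring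
      rw [this]
      have h5 : 0 ≤ a * Real.exp (2 * b * t) := by positivity
      have h6 : (2 * a + max B 0 * ((1 / 2) ^ n * (1 / 2))) * Real.exp (2 * b * t) =
        c / 2 * Real.exp (2 * b * t) + a * Real.exp (2 * b * t) := by rw [hc]; ring
      rw [h6]
      linarith
  intro t ht
  have lim : Tendsto (fun n : ℕ => (2 * a + max B 0 * (1 / 2) ^ n) * Real.exp (2 * b * t)) atTop
      (𝓝 ((2 * a + max B 0 * 0) * Real.exp (2 * b * t))) :=
    ((tendsto_pow_atTop_nhds_zero_of_lt_one (by norm_num) (by norm_num)).const_mul _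
      |>.const_add _).mul_const _
  have := ge_of_tendsto' lim fun n => key n t ht
  rw [mul_zero, add_zero] at this
  refine this.trans ?_
  gcongr
  exact ht.2

theorem IsDriver.comp_min {w : ℝ → ℕ} (hw : IsDriver w) (u : ℝ) : IsDriver fun v => w (min v u) := by
  refine ⟨fun v v' h => hw.mono (min_le_min_right u h), fun t => ?_⟩
  exact (hw.rightCont (min t u)).comp (f := fun v => min v u) (by fun_prop)
    fun v hv => min_le_min_right u hv

section

variable {k : ℕ} {Ω : Type*}

/-- The family of paths, indexed by `ℝ` through `Real.toNNReal`. -/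
def paths (Y : Fin k → ℝ≥0 → Ω → ℕ) (ω : Ω) (i : Fin k) (v : ℝ) : ℕ := Y i v.toNNReal ω

/-- The family of processes whose `i`-th member is stopped at `u`. -/
def stopped (Y : Fin k → ℝ≥0 → Ω → ℕ) (i : Fin k) (u : ℝ≥0) (j : Fin k) (v : ℝ≥0) (ω : Ω) : ℕ :=
  Y j (if j = i then min v u else v) ω

theorem isDriver_stopped {Y : Fin k → ℝ≥0 → Ω → ℕ} (hd : ∀ ω i, IsDriver (paths Y ω i))
    (i : Fin k) (u : ℝ≥0) (ω : Ω) (j : Fin k) : IsDriver (paths (stopped Y i u) ω j) := by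
  by_cases hj : j = i
  · have : paths (stopped Y i u) ω j = fun v => paths Y ω j (min v u) := by
      funext v
      have hmin : Real.toNNReal (min v u) = min v.toNNReal u := by
        rw [Monotone.map_min (fun _ _ h => Real.toNNReal_mono h), Real.toNNReal_coe]
      simp only [paths, stopped, hj, if_true, hmin]
    rw [this]
    exact (hd ω j).comp_min u
  · have : paths (stopped Y i u) ω j = paths Y ω j := by
      funext v
      simp [paths, stopped, hj]
    rw [this]
    exact hd ω j

variable {r : Fin k → ℝ → (Fin k → ℕ) → ℝ} {R : ℝ}

/-- A clock that has not reached `u` has not noticed the stopping at `u`. The hypothesis may concern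
either system, so that events for one can be rewritten as events for the other. -/
theorem IsRate.truncSol_stopped (hr : IsRate r R) (hR : 0 ≤ R) {Y : Fin k → ℝ≥0 → Ω → ℕ}
    (hd : ∀ ω i, IsDriver (paths Y ω i)) (i : Fin k) (u : ℝ≥0) (ω : Ω) (m : ℕ) {t : ℝ} (ht : 0 ≤ t)
    (h : clock (trunc r m) (truncSol (paths Y ω) r m) i t < u ∨
      clock (trunc r m) (truncSol (paths (stopped Y i u) ω) r m) i t < u) :
    clock (trunc r m) (truncSol (paths Y ω) r m) i t =
      clock (trunc r m) (truncSol (paths (stopped Y i u) ω) r m) i t ∧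
    truncSol (paths Y ω) r m t = truncSol (paths (stopped Y i u) ω) r m t := by
  have hst := isDriver_stopped hd i u ω
  have heq : ∀ c : ℝ, c < u → ∀ j, ∀ v, (j = i → v ≤ c) →
      paths Y ω j v = paths (stopped Y i u) ω j v := by
    intro c hc j v hv
    simp only [paths, stopped]
    split_ifs with hj
    · rw [min_eq_left (Real.toNNReal_le_iff_le_coe.2 ((hv hj).trans hc.le))]
    · rfl
  have key : ∀ s ∈ Icc 0 t,
      truncSol (paths Y ω) r m s = truncSol (paths (stopped Y i u) ω) r m s := by
    rcases h with h | h
    · exact hr.truncSol_congr hR (hd ω) hst fun j v hv => heq _ h j v fun hj => hj ▸ hv.2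
    · intro s hs
      refine (hr.truncSol_congr hR hst (hd ω) (fun j v hv => ?_) s hs).symm
      exact (heq _ h j v fun hj => hj ▸ hv.2).symm
  exact ⟨clock_congr ht (fun j s hs => by rw [key s ⟨hs.1, hs.2.le⟩]) i, key t ⟨ht, le_rfl⟩⟩

/-- The information in all processes but the `i`-th, and in the `i`-th one up to time `u`. -/
abbrev past (Y : Fin k → ℝ≥0 → Ω → ℕ) (i : Fin k) (u : ℝ≥0) : MeasurableSpace Ω :=
  MeasurableSpace.comap (fun ω j (v : ℝ≥0) => stopped Y i u j v ω) inferInstance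

theorem past_le [mΩ : MeasurableSpace Ω] {Y : Fin k → ℝ≥0 → Ω → ℕ} (hm : ∀ i t, Measurable (Y i t)) (i : Fin k) (u : ℝ≥0) :
    past Y i u ≤ mΩ :=
  (measurable_pi_iff.2 fun _ => measurable_pi_iff.2 fun _ => hm _ _ :
    Measurable fun ω j (v : ℝ≥0) => stopped Y i u j v ω).comap_le

theorem measurable_stopped (Y : Fin k → ℝ≥0 → Ω → ℕ) (i : Fin k) (u : ℝ≥0) (j : Fin k) (v : ℝ≥0) :
    Measurable[past Y i u] (stopped Y i u j v) := by
  have h := comap_measurable (m := (inferInstance : MeasurableSpace (Fin k → ℝ≥0 → ℕ)))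
    (fun ω j (v : ℝ≥0) => stopped Y i u j v ω)
  exact ((measurable_pi_apply v).comp (measurable_pi_apply j)).comp h

/-- On this event `Y` may be replaced by its stopped version, which is measurable for the past. The
bound on the total serves the untruncated clock: with level `n + 1` it certifies that the truncation
has not acted. -/
theorem IsRate.exists_past (hr : IsRate r R) (hR : 0 ≤ R) {Y : Fin k → ℝ≥0 → Ω → ℕ}
    (hd : ∀ ω i, IsDriver (paths Y ω i)) (i : Fin k) (u : ℝ≥0) {t : ℝ} (ht : 0 ≤ t)
    (m n : ℕ) :
    MeasurableSet[past Y i u] {ω | clock (trunc r m) (truncSol (paths Y ω) r m) i t < u ∧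
      ∑ j, truncSol (paths Y ω) r m t j ≤ n} := by
  have : {ω | clock (trunc r m) (truncSol (paths Y ω) r m) i t < u ∧
      ∑ j, truncSol (paths Y ω) r m t j ≤ n} =
      {ω | clock (trunc r m) (truncSol (paths (stopped Y i u) ω) r m) i t < u ∧
      ∑ j, truncSol (paths (stopped Y i u) ω) r m t j ≤ n} := by
    ext ω
    constructor
    · intro h
      obtain ⟨h1, h2⟩ := hr.truncSol_stopped hR hd i u ω m ht (Or.inl h.1)
      exact ⟨h1 ▸ h.1, h2 ▸ h.2⟩
    · intro h
      obtain ⟨h1, h2⟩ := hr.truncSol_stopped hR hd i u ω m ht (Or.inr h.1)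
      exact ⟨h1.symm ▸ h.1, h2.symm ▸ h.2⟩
  rw [this]
  let := past Y i u
  have hm := hr.measurable_truncSol_uncurry (W := fun ω => paths (stopped Y i u) ω)
    (fun ω => isDriver_stopped hd i u ω) (fun j v => measurable_stopped Y i u j v.toNNReal) m
  refine MeasurableSet.inter ?_ ?_
  · have h1 := (hr.measurable_clock_uncurry (A := fun ω => truncSol (paths (stopped Y i u) ω) r m)
      hm m i).comp (measurable_prodMk_left (x := t))
    exact measurableSet_lt h1 measurable_const
  · have h1 := hm.comp (measurable_prodMk_left (x := t))
    have h2 : Measurable fun a : Fin k → ℕ => ∑ j, a j := measurable_of_countable _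
    exact measurableSet_le (h2.comp h1) measurable_const

variable [mΩ : MeasurableSpace Ω] {P : Measure Ω}

theorem indep_past [IsProbabilityMeasure P] {Y : Fin k → ℝ≥0 → Ω → ℕ}
    (hY : ∀ i, IsUnitPoissonProcess P (Y i)) (hind : iIndepFun (fun i ω t => Y i t ω) P)
    (i : Fin k) (a b : ℝ≥0) (h : a ≤ b) :
    Indep (MeasurableSpace.comap (fun ω => Y i b ω - Y i a ω) ⊤) (past Y i a) P :=
  (IndepFun_iff_Indep _ _ _).1 (indepFun_stopped hY hind i h)

/-- The truncated clock is bounded by `R (1 + m) t`, so optional stopping applies without prior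
moment bounds. -/
theorem IsRate.lintegral_truncSol [IsProbabilityMeasure P] (hr : IsRate r R) (hR : 0 ≤ R)
    {Y : Fin k → ℝ≥0 → Ω → ℕ} (hd : ∀ ω i, IsDriver (paths Y ω i))
    (hY : ∀ i, IsUnitPoissonProcess P (Y i)) (hind : iIndepFun (fun i ω t => Y i t ω) P)
    (i : Fin k) {t : ℝ} (ht : 0 ≤ t) (m : ℕ) :
    ∫⁻ ω, (truncSol (paths Y ω) r m t i : ENNReal) ∂P =
      ∫⁻ ω, ENNReal.ofReal (clock (trunc r m) (truncSol (paths Y ω) r m) i t) ∂P := by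
  have hm := hr.measurable_truncSol_uncurry (W := fun ω => paths Y ω) hd
    (fun j v => (hY j).measurable v.toNNReal) m
  have hc : Measurable fun ω => clock (trunc r m) (truncSol (paths Y ω) r m) i t :=
    (hr.measurable_clock_uncurry (A := fun ω => truncSol (paths Y ω) r m)
      hm m i).comp (measurable_prodMk_left (x := t))
  have h0 : ∀ ω, 0 ≤ clock (trunc r m) (truncSol (paths Y ω) r m) i t := fun ω =>
    clock_nonneg (trunc_nonneg hr.nonneg m) _ _ ht
  have hle : ∀ ω, clock (trunc r m) (truncSol (paths Y ω) r m) i t ≤ R * (1 + m) * t := by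
    intro ω
    have := intervalIntegral.integral_mono_on ht
      (hr.intervalIntegrable_trunc hR m i (hr.measurable_truncSol hR (hd ω) m) 0 t)
      (intervalIntegrable_const (c := R * (1 + m))) fun s _ => hr.trunc_le hR m i s _
    rwa [intervalIntegral.integral_const, sub_zero, smul_eq_mul, mul_comm t] at this
  have := (hY i).lintegral_stopped (past_le (fun i t => (hY i).measurable t) i) (indep_past hY hind i)
    (θ := fun ω => (clock (trunc r m) (truncSol (paths Y ω) r m) i t).toNNReal) ?_
    hc.real_toNNReal.aemeasurable ?_
  · refine Eq.trans ?_ this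
    refine lintegral_congr fun ω => ?_
    rw [hr.truncSol_eq hR (hd ω) m t ht]
    rfl
  · intro u
    refine ⟨⋃ n : ℕ, {ω | clock (trunc r m) (truncSol (paths Y ω) r m) i t < u ∧
      ∑ j, truncSol (paths Y ω) r m t j ≤ n},
      MeasurableSet.iUnion fun n => hr.exists_past hR hd i u ht m n, EventuallyEq.of_eq (Set.ext fun ω => ?_)⟩
    rw [mem_ofPred_eq, Real.toNNReal_lt_iff_lt_coe (h0 ω), mem_iUnion]
    exact ⟨fun h => ⟨_, h, le_rfl⟩, fun ⟨_, h, _⟩ => h⟩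
  · refine ne_top_of_le_ne_top (b := ∫⁻ ω, ENNReal.ofReal (R * (1 + m) * t) ∂P) (by simp) ?_
    exact lintegral_mono fun ω => ENNReal.ofReal_le_ofReal (hle ω)

theorem ofReal_clock {r : Fin k → ℝ → (Fin k → ℕ) → ℝ} (hr : ∀ i t a, 0 ≤ r i t a)
    {A : ℝ → Fin k → ℕ} {i : Fin k} {t : ℝ} (ht : 0 ≤ t)
    (hint : IntervalIntegrable (fun s => r i s (A s)) volume 0 t) :
    ENNReal.ofReal (clock r A i t) = ∫⁻ s in Ioc 0 t, ENNReal.ofReal (r i s (A s)) := by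
  rw [clock, intervalIntegral.integral_of_le ht,
    ofReal_integral_eq_lintegral_ofReal hint.1 (Eventually.of_forall fun s => hr _ _ _)]

/-- By optional stopping and linear growth the mean total satisfies `n(s) ≤ k R (s + ∫₀ˢ n)`.
Grönwall yields a bound free of `m`. -/
theorem IsRate.lintegral_sum_truncSol_le [IsProbabilityMeasure P] (hr : IsRate r R) (hR : 0 ≤ R)
    {Y : Fin k → ℝ≥0 → Ω → ℕ} (hd : ∀ ω i, IsDriver (paths Y ω i))
    (hY : ∀ i, IsUnitPoissonProcess P (Y i)) (hind : iIndepFun (fun i ω t => Y i t ω) P)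
    {T t : ℝ} (ht : t ∈ Icc 0 T) (m : ℕ) :
    ∫⁻ ω, ((∑ j, truncSol (paths Y ω) r m t j : ℕ) : ENNReal) ∂P ≤
      ENNReal.ofReal (2 * (k * R * T) * Real.exp (2 * (k * R) * T)) := by
  have hm := hr.measurable_truncSol_uncurry (W := fun ω => paths Y ω) hd
    (fun j v => (hY j).measurable v.toNNReal) m
  set N : ℝ → Ω → ℕ := fun s ω => ∑ j, truncSol (paths Y ω) r m s j with hN
  have hNm : Measurable fun p : ℝ × Ω => N p.1 p.2 :=
    (measurable_of_countable fun a : Fin k → ℕ => ∑ j, a j).comp hm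
  have hNm' : Measurable fun p : ℝ × Ω => (N p.1 p.2 : ENNReal) :=
    (measurable_of_countable _).comp hNm
  set n : ℝ → ENNReal := fun s => ∫⁻ ω, (N s ω : ENNReal) ∂P with hn
  have hnm : Measurable n := hNm'.lintegral_prod_right'
  have htr : ∀ i, Measurable fun p : ℝ × Ω =>
      ENNReal.ofReal (trunc r m i p.1 (truncSol (paths Y p.2) r m p.1)) := fun i =>
    ((hr.measurable_uncurry_trunc m i).comp (measurable_fst.prodMk hm)).ennreal_ofReal
  have hclock : ∀ i s, 0 ≤ s → ∫⁻ ω, (truncSol (paths Y ω) r m s i : ENNReal) ∂P =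
      ∫⁻ v in Ioc 0 s, ∫⁻ ω, ENNReal.ofReal (trunc r m i v (truncSol (paths Y ω) r m v)) ∂P := by
    intro i s hs
    rw [hr.lintegral_truncSol hR hd hY hind i hs m, ← lintegral_lintegral_swap]
    · refine lintegral_congr fun ω => ofReal_clock (trunc_nonneg hr.nonneg m) hs ?_
      exact hr.intervalIntegrable_trunc hR m i (hr.measurable_truncSol hR (hd ω) m) 0 s
    · exact ((htr i).comp measurable_swap).aemeasurable
  have hnsum : ∀ s, n s = ∑ i, ∫⁻ ω, (truncSol (paths Y ω) r m s i : ENNReal) ∂P := by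
    intro s
    rw [← lintegral_finsetSum]
    · simp [hn, hN]
    · intro i _
      exact (measurable_of_countable (fun a : Fin k → ℕ => (a i : ENNReal))).comp
        (hm.comp (measurable_prodMk_left (x := s)))
  -- This bound depends on `m` and only provides the finiteness that Grönwall presupposes.
  have hbound : ∀ s ∈ Icc 0 T, n s ≤ ENNReal.ofReal (k * (R * (1 + m) * T)) := by
    intro s hs
    rw [hnsum, ENNReal.ofReal_mul (by positivity), ENNReal.ofReal_natCast]
    refine (Finset.sum_le_card_nsmul _ _ (ENNReal.ofReal (R * (1 + m) * T)) fun i _ => ?_).trans ?_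
    · rw [hclock i s hs.1]
      calc _ ≤ ∫⁻ v in Ioc 0 s, ∫⁻ ω, ENNReal.ofReal (R * (1 + m)) ∂P :=
            lintegral_mono fun v => lintegral_mono fun ω =>
              ENNReal.ofReal_le_ofReal (hr.trunc_le hR _ _ _ _)
        _ = ENNReal.ofReal (R * (1 + m) * s) := by
            rw [ENNReal.ofReal_mul (by positivity : 0 ≤ R * (1 + (m : ℝ)))]
            rw [lintegral_const, lintegral_const, measure_univ, mul_one,
              Measure.restrict_apply_univ, Real.volume_Ioc, sub_zero]
        _ ≤ _ := by gcongr; exact hs.2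
    · simp
  have hstep : ∀ s ∈ Icc 0 T,
      n s ≤ ENNReal.ofReal (k * R) * (ENNReal.ofReal s + ∫⁻ v in Ioc 0 s, n v) := by
    intro s hs
    rw [hnsum, ENNReal.ofReal_mul (by positivity), ENNReal.ofReal_natCast]
    refine (Finset.sum_le_card_nsmul _ _
      (ENNReal.ofReal R * (ENNReal.ofReal s + ∫⁻ v in Ioc 0 s, n v)) fun i _ => ?_).trans ?_
    · rw [hclock i s hs.1]
      calc _ ≤ ∫⁻ v in Ioc 0 s, ∫⁻ ω, ENNReal.ofReal R * (1 + (N v ω : ENNReal)) ∂P := by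
            refine lintegral_mono fun v => lintegral_mono fun ω => ?_
            refine (ENNReal.ofReal_le_ofReal
              ((trunc_le_self hr.nonneg _ _ _ _).trans (hr.le _ _ _))).trans ?_
            rw [ENNReal.ofReal_mul hR, ENNReal.ofReal_add zero_le_one (by positivity)]
            simp [hN, ENNReal.ofReal_sum_of_nonneg]
        _ = _ := by
            have : ∀ v, ∫⁻ ω, ENNReal.ofReal R * (1 + (N v ω : ENNReal)) ∂P =
                ENNReal.ofReal R * (1 + n v) := by
              intro v
              rw [lintegral_const_mul' _ _ ENNReal.ofReal_ne_top,
                lintegral_add_left measurable_const]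
              simp [hn]
            simp_rw [this]
            rw [lintegral_const_mul' _ _ ENNReal.ofReal_ne_top,
              lintegral_add_left measurable_const]
            simp
    · simp [mul_assoc]
  have hntop : ∀ s ∈ Icc 0 T, n s ≠ ⊤ := fun s hs =>
    ne_top_of_le_ne_top ENNReal.ofReal_ne_top (hbound s hs)
  have hT0 : 0 ≤ T := ht.1.trans ht.2
  have hφB : ∀ s ∈ Icc 0 T, (n s).toReal ≤ k * (R * (1 + m) * T) := fun s hs =>
    ENNReal.toReal_le_of_le_ofReal (by positivity) (hbound s hs)
  have := le_of_le_add_mul_integral (φ := fun s => (n s).toReal) (a := k * R * T) (b := k * R)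
    (B := k * (R * (1 + m) * T)) (T := T) (by positivity) (by positivity) ?_ hφB ?_ t ht
  · change n t ≤ _
    rw [← ENNReal.ofReal_toReal (hntop t ht)]
    exact ENNReal.ofReal_le_ofReal this
  · rw [intervalIntegrable_iff_integrableOn_Ioc_of_le hT0]
    refine Measure.integrableOn_of_bounded (M := k * (R * (1 + m) * T)) (by simp)
      hnm.ennreal_toReal.aestronglyMeasurable ?_
    filter_upwards [ae_restrict_mem measurableSet_Ioc] with s hs
    rw [Real.norm_of_nonneg ENNReal.toReal_nonneg]
    exact hφB s ⟨hs.1.le, hs.2⟩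
  · intro s hs
    have hlt : ∀ᵐ v ∂(volume.restrict (Ioc 0 s)), n v < ⊤ := by
      filter_upwards [ae_restrict_mem measurableSet_Ioc] with v hv
      exact (hntop v ⟨hv.1.le, hv.2.trans hs.2⟩).lt_top
    have hfin : ∫⁻ v in Ioc 0 s, n v ≠ ⊤ := by
      refine ne_top_of_le_ne_top (b := ∫⁻ v in Ioc 0 s, ENNReal.ofReal (k * (R * (1 + m) * T))) ?_
        (setLIntegral_mono measurable_const fun v hv => hbound v ⟨hv.1.le, hv.2.trans hs.2⟩)
      simp [ENNReal.mul_eq_top]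
    rw [intervalIntegral.integral_of_le hs.1, integral_toReal hnm.aemeasurable hlt]
    have h1 := ENNReal.toReal_mono (by
      exact ENNReal.mul_ne_top ENNReal.ofReal_ne_top
        (ENNReal.add_ne_top.2 ⟨ENNReal.ofReal_ne_top, hfin⟩)) (hstep s hs)
    rw [ENNReal.toReal_mul, ENNReal.toReal_add ENNReal.ofReal_ne_top hfin,
      ENNReal.toReal_ofReal (by positivity), ENNReal.toReal_ofReal hs.1] at h1
    have h2 : k * R * s ≤ k * R * T := by gcongr; exact hs.2
    linarith

end

end AdjustedFluid

/-! ### First moments of the untruncated solution. -/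

namespace AdjustedFluid

variable {k : ℕ} {Ω : Type*} [mΩ : MeasurableSpace Ω] {P : Measure Ω}
  {r : Fin k → ℝ → (Fin k → ℕ) → ℝ} {R : ℝ}

/-- A family of Poisson processes may be modified on a null set so that all paths are monotone and
right-continuous. -/
theorem exists_regular {Y : Fin k → ℝ≥0 → Ω → ℕ} (hY : ∀ i, IsUnitPoissonProcess P (Y i))
    (hind : iIndepFun (fun i ω t => Y i t ω) P) :
    ∃ Y' : Fin k → ℝ≥0 → Ω → ℕ, (∀ i, IsUnitPoissonProcess P (Y' i)) ∧
      iIndepFun (fun i ω t => Y' i t ω) P ∧ (∀ ω i, IsDriver (paths Y' ω i)) ∧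
      ∀ᵐ ω ∂P, ∀ i t, Y' i t ω = Y i t ω := by
  classical
  set good : Ω → Prop := fun ω => ∀ i, (Monotone fun t => Y i t ω) ∧
    ∀ t, ContinuousWithinAt (fun u => Y i u ω) (Ici t) t with hgood
  have hg : ∀ᵐ ω ∂P, good ω :=
    ae_all_iff.2 fun i => (hY i).monotone.and (hY i).rightCont
  -- The bad set need not be measurable; a measurable null superset keeps the modified processes
  -- measurable.
  set N := toMeasurable P {ω | ¬ good ω} with hN
  have hNm : MeasurableSet N := measurableSet_toMeasurable _ _
  have hN0 : ∀ᵐ ω ∂P, ω ∉ N := by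
    rw [ae_iff]
    simpa [hN, measure_toMeasurable] using! ae_iff.1 hg
  have hNg : ∀ ω ∉ N, good ω := fun ω hω => by
    by_contra hcon
    exact hω (subset_toMeasurable _ _ hcon)
  set Y' : Fin k → ℝ≥0 → Ω → ℕ := fun i t ω => if ω ∈ N then 0 else Y i t ω with hY'
  have heq : ∀ᵐ ω ∂P, ∀ i t, Y' i t ω = Y i t ω := by
    filter_upwards [hN0] with ω hω i t
    simp [hY', hω]
  have hev : ∀ ω, (∀ i t, Y' i t ω = 0) ∨ ((∀ i t, Y' i t ω = Y i t ω) ∧ good ω) := fun ω => by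
    by_cases hω : ω ∈ N
    · exact Or.inl fun i t => by simp [hY', hω]
    · exact Or.inr ⟨fun i t => by simp [hY', hω], hNg ω hω⟩
  refine ⟨Y', fun i => ⟨fun t => ?_, ?_, ?_, ?_, ?_, fun s t hst => ?_⟩, ?_, fun ω i => ?_, heq⟩
  · exact Measurable.ite hNm measurable_const ((hY i).measurable t)
  · filter_upwards [heq, (hY i).zero] with ω h1 h2
    rw [h1, h2]
  · filter_upwards [heq, (hY i).monotone] with ω h1 h2
    simpa only [h1] using h2
  · filter_upwards [heq, (hY i).rightCont] with ω h1 h2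
    simpa only [h1] using h2
  · intro n t ht
    refine ((hY i).indepIncrements n t ht).congr fun j => ?_
    filter_upwards [heq] with ω h1
    simp only [h1]
  · refine ((hY i).increments s t hst).congr ?_
    filter_upwards [heq] with ω h1
    simp only [h1]
  · refine hind.congr fun i => ?_
    filter_upwards [heq] with ω h1
    funext t
    rw [h1]
  · rcases hev ω with h | ⟨h, hg⟩
    · have : paths Y' ω i = fun _ => 0 := funext fun v => h i _
      rw [this]
      exact ⟨monotone_const, fun t => continuousWithinAt_const⟩
    · have : paths Y' ω i = fun v => Y i v.toNNReal ω := funext fun v => h i _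
      rw [this]
      refine ⟨fun v v' hv => (hg i).1 (Real.toNNReal_mono hv), fun t => ?_⟩
      exact ((hg i).2 t.toNNReal).comp (f := fun v : ℝ => v.toNNReal)
        continuous_real_toNNReal.continuousWithinAt fun v hv => Real.toNNReal_mono hv

/-- The total count at `T` is finite and bounds the whole path, so truncation above it is invisible.
-/
theorem IsRate.eventually_eq_truncSol (hr : IsRate r R) (hR : 0 ≤ R)
    {W : Fin k → ℝ → ℕ} (hW : ∀ i, IsDriver (W i)) {T : ℝ} (hT : 0 ≤ T)
    {A : ℝ → Fin k → ℕ} (hA : SolvesUpTo W r T A) :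
    ∀ᶠ m in atTop, (∀ s ∈ Icc 0 T, truncSol W r m s = A s) ∧
      (∀ i, ∀ s ∈ Icc 0 T, trunc r m i s (truncSol W r m s) = r i s (A s)) ∧
      ∀ i, ∀ s ∈ Icc 0 T, clock (trunc r m) (truncSol W r m) i s = clock r A i s := by
  filter_upwards [eventually_gt_atTop (∑ j, A T j)] with m hm
  have h1 := hr.eq_truncSol hR hW hT hA hm
  have h2 : ∀ i, ∀ s ∈ Icc 0 T, trunc r m i s (truncSol W r m s) = r i s (A s) := by
    intro i s hs
    rw [← h1 s hs, trunc_eq]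
    exact (Finset.sum_le_sum fun j _ => hA.mono hW hr.nonneg hs.1 hs.2 le_rfl j).trans_lt hm
  exact ⟨fun s hs => (h1 s hs).symm, h2, fun i s hs =>
    clock_congr hs.1 (fun i v hv => h2 i v ⟨hv.1, hv.2.le.trans hs.2⟩) i⟩

/-- First moments of the counts of a solution of the time change equation with rates of linear
growth: they are uniformly bounded, and given by the integrated mean rates. -/
theorem IsRate.moments [IsProbabilityMeasure P] (hr : IsRate r R) (hR : 0 ≤ R)
    {Y : Fin k → ℝ≥0 → Ω → ℕ} (hY : ∀ i, IsUnitPoissonProcess P (Y i))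
    (hind : iIndepFun (fun i ω t => Y i t ω) P) {T : ℝ} (hT : 0 ≤ T)
    {A : Ω → ℝ → Fin k → ℕ} (hA : ∀ᵐ ω ∂P, SolvesUpTo (paths Y ω) r T (A ω)) :
    (∃ K, ∀ t ∈ Icc 0 T, ∫ ω, ∑ j, (A ω t j : ℝ) ∂P ≤ K) ∧
    (∀ t ∈ Icc 0 T, ∀ i, Integrable (fun ω => (A ω t i : ℝ)) P) ∧
    (∀ t ∈ Icc 0 T, ∀ i, Integrable (fun ω => r i t (A ω t)) P) ∧
    (∀ i, IntervalIntegrable (fun s => ∫ ω, r i s (A ω s) ∂P) volume 0 T) ∧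
    ∀ t ∈ Icc 0 T, ∀ i, ∫ ω, (A ω t i : ℝ) ∂P = ∫ s in (0 : ℝ)..t, ∫ ω, r i s (A ω s) ∂P := by
  obtain ⟨D, hD, hDind, hd, hDY⟩ := exists_regular hY hind
  have hAD : ∀ᵐ ω ∂P, SolvesUpTo (paths D ω) r T (A ω) := by
    filter_upwards [hA, hDY] with ω h1 h2
    exact h1.congr_driver fun i s _ => (h2 i _).symm
  have hev : ∀ᵐ ω ∂P, ∀ᶠ m in atTop, (∀ s ∈ Icc 0 T, truncSol (paths D ω) r m s = A ω s) ∧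
      (∀ i, ∀ s ∈ Icc 0 T, trunc r m i s (truncSol (paths D ω) r m s) = r i s (A ω s)) ∧
      ∀ i, ∀ s ∈ Icc 0 T,
        clock (trunc r m) (truncSol (paths D ω) r m) i s = clock r (A ω) i s := by
    filter_upwards [hAD] with ω h1
    exact hr.eventually_eq_truncSol hR (hd ω) hT h1
  have hm := fun m => hr.measurable_truncSol_uncurry (W := fun ω => paths D ω) hd
    (fun j v => (hD j).measurable v.toNNReal) m
  have hmt := fun m (s : ℝ) => (hm m).comp (measurable_prodMk_left (x := s))
  have hcm : ∀ m i s, Measurable fun ω => clock (trunc r m) (truncSol (paths D ω) r m) i s :=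
    fun m i s => (hr.measurable_clock_uncurry (A := fun ω => truncSol (paths D ω) r m)
      (hm m) m i).comp (measurable_prodMk_left (x := s))
  -- a jointly measurable version of the rates along the path
  set g : Fin k → ℝ × Ω → ℝ := fun i p =>
    limsup (fun m => trunc r m i p.1 (truncSol (paths D p.2) r m p.1)) atTop with hg
  have hgm : ∀ i, Measurable (g i) := fun i =>
    Measurable.limsup fun m => (hr.measurable_uncurry_trunc m i).comp (measurable_fst.prodMk (hm m))
  have hgA : ∀ᵐ ω ∂P, ∀ i, ∀ s ∈ Icc 0 T, g i (s, ω) = r i s (A ω s) := by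
    filter_upwards [hev] with ω h i s hs
    exact (tendsto_const_nhds.congr' (h.mono fun m hm => (hm.2.1 i s hs).symm)).limsup_eq
  have hlimA : ∀ s ∈ Icc 0 T, ∀ᵐ ω ∂P,
      ∀ᶠ m in atTop, truncSol (paths D ω) r m s = A ω s := fun s hs => by
    filter_upwards [hev] with ω h
    exact h.mono fun m hm => hm.1 s hs
  have hAm : ∀ s ∈ Icc 0 T, AEMeasurable (fun ω => A ω s) P := by
    intro s hs
    refine aemeasurable_of_tendsto_metrizable_ae atTop (fun m => (hmt m s).aemeasurable) ?_
    filter_upwards [hlimA s hs] with ω h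
    exact tendsto_const_nhds.congr' (h.mono fun m hm => hm.symm)
  set K := ENNReal.ofReal (2 * (k * R * T) * Real.exp (2 * (k * R) * T)) with hK
  have hKtop : K ≠ ⊤ := ENNReal.ofReal_ne_top
  -- Fatou along truncated counts that are eventually constant in `m`.
  have hbound : ∀ s ∈ Icc 0 T, ∫⁻ ω, ((∑ j, A ω s j : ℕ) : ENNReal) ∂P ≤ K := by
    intro s hs
    have h1 : ∫⁻ ω, ((∑ j, A ω s j : ℕ) : ENNReal) ∂P = ∫⁻ ω, liminf (fun m =>
        ((∑ j, truncSol (paths D ω) r m s j : ℕ) : ENNReal)) atTop ∂P := by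
      refine lintegral_congr_ae ?_
      filter_upwards [hlimA s hs] with ω h
      refine (Tendsto.liminf_eq ?_).symm
      exact tendsto_const_nhds.congr' (h.mono fun m hm => by simp only [hm])
    rw [h1]
    refine (lintegral_liminf_le fun m => ?_).trans ?_
    · exact (measurable_of_countable fun a : Fin k → ℕ => ((∑ j, a j : ℕ) : ENNReal)).comp (hmt m s)
    · refine (liminf_le_liminf (v := fun _ => K)
        (Eventually.of_forall fun m => hr.lintegral_sum_truncSol_le hR hd hD hDind hs m)).trans ?_
      simp
  have hlimc : ∀ i, ∀ s ∈ Icc 0 T, ∀ᵐ ω ∂P, Tendsto (fun m =>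
      clock (trunc r m) (truncSol (paths D ω) r m) i s) atTop (𝓝 (clock r (A ω) i s)) := by
    intro i s hs
    filter_upwards [hev] with ω h
    exact tendsto_const_nhds.congr' (h.mono fun m hm => (hm.2.2 i s hs).symm)
  have hcA : ∀ i, ∀ s ∈ Icc 0 T, AEMeasurable (fun ω => clock r (A ω) i s) P := fun i s hs =>
    aemeasurable_of_tendsto_metrizable_ae atTop (fun m => (hcm m i s).aemeasurable) (hlimc i s hs)
  have hrle : ∀ i s ω, ENNReal.ofReal (r i s (A ω s)) ≤
      ENNReal.ofReal R * (1 + ((∑ j, A ω s j : ℕ) : ENNReal)) := by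
    intro i s ω
    refine (ENNReal.ofReal_le_ofReal (hr.le _ _ _)).trans ?_
    rw [ENNReal.ofReal_mul hR, ENNReal.ofReal_add zero_le_one (by positivity)]
    simp [ENNReal.ofReal_sum_of_nonneg]
  have hrint : ∀ i, ∀ s ∈ Icc 0 T,
      ∫⁻ ω, ENNReal.ofReal (r i s (A ω s)) ∂P ≤ ENNReal.ofReal R * (1 + K) := by
    intro i s hs
    refine (lintegral_mono fun ω => hrle i s ω).trans ?_
    rw [lintegral_const_mul' _ _ ENNReal.ofReal_ne_top, lintegral_add_left measurable_const]
    gcongr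
    · simp
    · exact hbound s hs
  have hRK : ENNReal.ofReal R * (1 + K) ≠ ⊤ :=
    ENNReal.mul_ne_top ENNReal.ofReal_ne_top (by simp [hKtop])
  have hrm : ∀ i, ∀ s ∈ Icc 0 T, AEMeasurable (fun ω => r i s (A ω s)) P := fun i s hs =>
    (measurable_of_countable fun a => r i s a).comp_aemeasurable (hAm s hs)
  have hrI : ∀ s ∈ Icc 0 T, ∀ i, Integrable (fun ω => r i s (A ω s)) P := by
    intro s hs i
    refine ⟨(hrm i s hs).aestronglyMeasurable, ?_⟩
    rw [hasFiniteIntegral_iff_ofReal (Eventually.of_forall fun ω => hr.nonneg _ _ _)]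
    exact (hrint i s hs).trans_lt hRK.lt_top
  have hprod : ∀ i, ∀ t ∈ Icc 0 T, Integrable (g i) ((volume.restrict (Ioc 0 t)).prod P) := by
    intro i t ht
    refine ⟨(hgm i).aestronglyMeasurable, ?_⟩
    rw [hasFiniteIntegral_iff_enorm, lintegral_prod _ (hgm i).enorm.aemeasurable]
    refine lt_of_le_of_lt (b := ∫⁻ s in Ioc 0 t, ENNReal.ofReal R * (1 + K)) ?_ ?_
    · refine setLIntegral_mono measurable_const fun s hs => ?_
      have hs' : s ∈ Icc 0 T := ⟨hs.1.le, hs.2.trans ht.2⟩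
      refine le_trans (le_of_eq (lintegral_congr_ae ?_)) (hrint i s hs')
      filter_upwards [hgA] with ω h
      rw [h i s hs', Real.enorm_of_nonneg (hr.nonneg _ _ _)]
    · rw [setLIntegral_const, Real.volume_Ioc]
      exact ENNReal.mul_lt_top hRK.lt_top ENNReal.ofReal_lt_top
  have hgE : ∀ i, ∀ s ∈ Icc 0 T, ∫ ω, g i (s, ω) ∂P = ∫ ω, r i s (A ω s) ∂P := fun i s hs =>
    integral_congr_ae (by filter_upwards [hgA] with ω h using h i s hs)
  have hcE : ∀ t ∈ Icc 0 T, ∀ i, ∫ ω, clock r (A ω) i t ∂P =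
      ∫ s in (0 : ℝ)..t, ∫ ω, r i s (A ω s) ∂P := by
    intro t ht i
    have h1 : ∫ ω, clock r (A ω) i t ∂P = ∫ ω, (∫ s in Ioc 0 t, g i (s, ω)) ∂P := by
      refine integral_congr_ae ?_
      filter_upwards [hgA] with ω h
      rw [clock, intervalIntegral.integral_of_le ht.1]
      exact setIntegral_congr_fun measurableSet_Ioc fun s hs =>
        (h i s ⟨hs.1.le, hs.2.trans ht.2⟩).symm
    rw [h1, integral_integral_swap (f := fun ω s => g i (s, ω)) (hprod i t ht).swap, intervalIntegral.integral_of_le ht.1]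
    exact setIntegral_congr_fun measurableSet_Ioc fun s hs => hgE i s ⟨hs.1.le, hs.2.trans ht.2⟩
  have hc0 : ∀ i, ∀ t ∈ Icc 0 T, ∀ ω, 0 ≤ clock r (A ω) i t := fun i t ht ω =>
    clock_nonneg hr.nonneg _ _ ht.1
  have hcI : ∀ i, ∀ t ∈ Icc 0 T, ∫⁻ ω, ENNReal.ofReal (clock r (A ω) i t) ∂P ≠ ⊤ := by
    intro i t ht
    refine ne_top_of_le_ne_top hKtop ?_
    have h1 : ∫⁻ ω, ENNReal.ofReal (clock r (A ω) i t) ∂P = ∫⁻ ω, liminf (fun m =>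
        ENNReal.ofReal (clock (trunc r m) (truncSol (paths D ω) r m) i t)) atTop ∂P := by
      refine lintegral_congr_ae ?_
      filter_upwards [hlimc i t ht] with ω h
      exact ((ENNReal.tendsto_ofReal h).liminf_eq).symm
    rw [h1]
    refine (lintegral_liminf_le fun m => (hcm m i t).ennreal_ofReal).trans ?_
    refine (liminf_le_liminf (v := fun _ => K) (Eventually.of_forall fun m => ?_)).trans (by simp)
    rw [← hr.lintegral_truncSol hR hd hD hDind i ht.1 m]
    refine le_trans (lintegral_mono fun ω => ?_)
      (hr.lintegral_sum_truncSol_le hR hd hD hDind ht m)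
    exact Nat.cast_le.2 <| Finset.single_le_sum (f := fun j => truncSol (paths D ω) r m t j)
      (fun j _ => Nat.zero_le _) (Finset.mem_univ i)
  -- Fatou gives only inequalities; the equality comes from optional stopping for the untruncated
  -- clock, whose mean is now known to be finite.
  have hcount : ∀ t ∈ Icc 0 T, ∀ i, ∫⁻ ω, (A ω t i : ENNReal) ∂P =
      ∫⁻ ω, ENNReal.ofReal (clock r (A ω) i t) ∂P := by
    intro t ht i
    have := (hD i).lintegral_stopped (past_le (fun i t => (hD i).measurable t) i)
      (indep_past hD hDind i) (θ := fun ω => (clock r (A ω) i t).toNNReal) ?_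
      (hcA i t ht).real_toNNReal (hcI i t ht)
    · refine Eq.trans (lintegral_congr_ae ?_) this
      filter_upwards [hAD] with ω h
      rw [h.eq t ht]
      rfl
    · intro u
      -- A total of at most `m` at level `m + 1` means that the truncation has not acted up to `t`,
      -- so `truncSol` is the true solution there.
      set S : ℕ → Set Ω := fun m => {ω | clock (trunc r (m + 1)) (truncSol (paths D ω) r (m + 1)) i t
        < u ∧ ∑ j, truncSol (paths D ω) r (m + 1) t j ≤ m} with hS
      refine ⟨⋃ m, S m, MeasurableSet.iUnion fun m => hr.exists_past hR hd i u ht.1 (m + 1) m, ?_⟩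
      have : ∀ᵐ ω ∂P, ω ∈ {ω | (clock r (A ω) i t).toNNReal < u} ↔ ω ∈ ⋃ m, S m := by
        filter_upwards [hAD] with ω h
        have ht' := h.mono_time ht.1 ht.2
        rw [Real.toNNReal_lt_iff_lt_coe (hc0 i t ht ω), mem_iUnion]
        constructor
        · intro h1
          have hm : ∑ j, A ω t j < (∑ j, A ω t j) + 1 := Nat.lt_succ_self _
          have h2 := hr.eq_truncSol hR (hd ω) ht.1 ht' hm
          refine ⟨∑ j, A ω t j, ?_, ?_⟩
          · rw [← clock_congr (r := r) (A := A ω) ht.1 fun i s hs => ?_]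
            · exact h1
            · rw [← h2 s ⟨hs.1, hs.2.le⟩, trunc_eq]
              exact (Finset.sum_le_sum fun j _ =>
                ht'.mono (hd ω) hr.nonneg hs.1 hs.2.le le_rfl j).trans_lt hm
          · rw [← h2 t ⟨ht.1, le_rfl⟩]
        · rintro ⟨m, h1, h2⟩
          have h3 := hr.solvesUpTo_truncSol hR (hd ω) (m + 1) t
          have h4 : ∀ i, ∀ s ∈ Icc 0 t, trunc r (m + 1) i s (truncSol (paths D ω) r (m + 1) s) =
              r i s (truncSol (paths D ω) r (m + 1) s) := fun i s hs =>
            trunc_eq ((Finset.sum_le_sum fun j _ => h3.mono (hd ω) (trunc_nonneg hr.nonneg _)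
              hs.1 hs.2 le_rfl j).trans_lt (Nat.lt_succ_of_le h2)) i s
          have h5 := (h3.congr_rate ht.1 h4).eqOn (hd ω) hr.nonneg ht'
          rw [clock_congr (r' := r) (B := A ω) ht.1 fun i s hs => ?_] at h1
          · exact h1
          · rw [h4 i s ⟨hs.1, hs.2.le⟩, h5 s ⟨hs.1, hs.2.le⟩]
      filter_upwards [this] with ω h
      exact propext h
  have hAint : ∀ t ∈ Icc 0 T, ∀ i, Integrable (fun ω => (A ω t i : ℝ)) P := by
    intro t ht i
    refine ⟨((measurable_of_countable fun a : Fin k → ℕ => (a i : ℝ)).comp_aemeasurable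
      (hAm t ht)).aestronglyMeasurable, ?_⟩
    rw [hasFiniteIntegral_iff_ofReal (Eventually.of_forall fun ω => Nat.cast_nonneg _)]
    simp only [ENNReal.ofReal_natCast]
    rw [hcount t ht i]
    exact (hcI i t ht).lt_top
  refine ⟨⟨K.toReal, fun t ht => ?_⟩, hAint, hrI, fun i => ?_, fun t ht i => ?_⟩
  · rw [integral_eq_lintegral_of_nonneg_ae (Eventually.of_forall fun ω => by positivity)
      (integrable_finsetSum _ fun i _ => hAint t ht i).1]
    refine ENNReal.toReal_mono hKtop (le_trans (le_of_eq ?_) (hbound t ht))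
    refine lintegral_congr fun ω => ?_
    rw [← ENNReal.ofReal_natCast]
    simp
  · rw [intervalIntegrable_iff_integrableOn_Ioc_of_le hT]
    refine (hprod i T ⟨hT, le_rfl⟩).integral_prod_left.congr ?_
    filter_upwards [ae_restrict_mem measurableSet_Ioc] with s hs
    exact hgE i s ⟨hs.1.le, hs.2⟩
  · rw [← hcE t ht i, integral_eq_lintegral_of_nonneg_ae
      (Eventually.of_forall fun ω => Nat.cast_nonneg _) (hAint t ht i).1,
      integral_eq_lintegral_of_nonneg_ae (Eventually.of_forall fun ω => hc0 i t ht ω)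
      (hcA i t ht).aestronglyMeasurable, ← hcount t ht i]
    simp only [ENNReal.ofReal_natCast]

end AdjustedFluid

namespace AdjustedFluid

/-! ### Law of large numbers. -/

section lln

variable {Ω : Type*} [mΩ : MeasurableSpace Ω] {P : Measure Ω}

/-- The law of large numbers for the Poisson process, in a form uniform in time. -/
theorem IsUnitPoissonProcess.ae_abs_sub_le {Y : ℝ≥0 → Ω → ℕ} (hY : IsUnitPoissonProcess P Y) :
    ∀ᵐ ω ∂P, ∀ ε : ℝ, 0 < ε → ∃ K : ℝ, ∀ v : ℝ≥0, |(Y v ω : ℝ) - v| ≤ K + ε * v := by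
  have hmono : Monotone fun n : ℕ => (n : ℝ≥0) := Nat.mono_cast
  set ξ : ℕ → Ω → ℝ := fun n ω => ((Y (n + 1 : ℕ) ω - Y n ω : ℕ) : ℝ) with hξ
  have hle : ∀ n : ℕ, (n : ℝ≥0) ≤ (n + 1 : ℕ) := fun n => hmono n.le_succ
  have hone : ∀ n : ℕ, ((n + 1 : ℕ) : ℝ≥0) - n = 1 := fun n => by simp
  have hξm : ∀ n, Measurable (ξ n) := fun n =>
    (measurable_of_countable _).comp ((hY.measurable _).sub (hY.measurable _))
  have hlint : ∫⁻ ω, ENNReal.ofReal (ξ 0 ω) ∂P = 1 := by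
    have := hY.lintegral_sub (hle 0)
    rw [hone 0] at this
    simpa [hξ, ENNReal.ofReal_natCast] using this
  have hint : Integrable (ξ 0) P := by
    refine ⟨(hξm 0).aestronglyMeasurable, ?_⟩
    rw [hasFiniteIntegral_iff_ofReal (Eventually.of_forall fun ω => Nat.cast_nonneg _), hlint]
    exact ENNReal.one_lt_top
  have hmean : ∫ ω, ξ 0 ω ∂P = 1 := by
    rw [integral_eq_lintegral_of_nonneg_ae (Eventually.of_forall fun ω => Nat.cast_nonneg _)
      (hξm 0).aestronglyMeasurable, hlint]
    rfl
  have hind : Pairwise (Function.onFun (IndepFun · · P) ξ) := fun i j hij => by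
    exact ((hY.indepIncrements.nat hmono).indepFun hij).comp (φ := fun n : ℕ => (n : ℝ))
      (ψ := fun n : ℕ => (n : ℝ)) (measurable_of_countable _) (measurable_of_countable _)
  have hid : ∀ i, IdentDistrib (ξ i) (ξ 0) P P := fun i => by
    have h1 := hY.increments _ _ (hle i)
    have h0 := hY.increments _ _ (hle 0)
    rw [hone] at h1 h0
    exact (h1.identDistrib h0).comp (u := fun n : ℕ => (n : ℝ)) (measurable_of_countable _)
  filter_upwards [strong_law_ae_real ξ hint hind hid, hY.zero, hY.monotone] with ω hlim h0 hm ε hε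
  rw [hmean] at hlim
  have hsum : ∀ n : ℕ, ∑ i ∈ Finset.range n, ξ i ω = Y n ω := fun n => by
    rw [hξ, ← Nat.cast_sum, Finset.sum_range_tsub (f := fun i : ℕ => Y i ω) (hm.comp hmono)]
    simp [h0]
  simp_rw [hsum] at hlim
  obtain ⟨N, hN⟩ := Metric.tendsto_atTop.1 hlim ε hε
  -- `K` absorbs the integers up to `N`; beyond them the relative error is below `ε`.
  set K := ∑ j ∈ Finset.range (N + 1), |(Y j ω : ℝ) - j| with hK
  have hK0 : 0 ≤ K := Finset.sum_nonneg fun _ _ => abs_nonneg _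
  have hnat : ∀ n : ℕ, |(Y n ω : ℝ) - n| ≤ K + ε * n := by
    intro n
    rcases lt_or_ge n (N + 1) with hn | hn
    · have := Finset.single_le_sum (f := fun j : ℕ => |(Y j ω : ℝ) - j|)
        (fun _ _ => abs_nonneg _) (Finset.mem_range.2 hn)
      have h2 : 0 ≤ ε * n := by positivity
      exact this.trans (by linarith)
    · have hn0 : (0 : ℝ) < n := by exact_mod_cast (by omega : 0 < n)
      have := hN n (by omega)
      rw [Real.dist_eq, div_sub_one hn0.ne', abs_div, abs_of_pos hn0, div_lt_iff₀ hn0] at this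
      linarith
  -- Squeezing `v` between consecutive integers costs at most the extra `ε + 1`.
  refine ⟨K + ε + 1, fun v => ?_⟩
  have hv1 : (⌊v⌋₊ : ℝ≥0) ≤ v := Nat.floor_le zero_le
  have hv2 : v ≤ ((⌊v⌋₊ + 1 : ℕ) : ℝ≥0) := by push_cast; exact (Nat.lt_floor_add_one v).le
  have h1 : (Y ⌊v⌋₊ ω : ℝ) ≤ Y v ω := by exact_mod_cast hm hv1
  have h2 : (Y v ω : ℝ) ≤ Y (⌊v⌋₊ + 1 : ℕ) ω := by exact_mod_cast hm hv2
  have h3 := abs_le.1 (hnat ⌊v⌋₊)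
  have h4 := abs_le.1 (hnat (⌊v⌋₊ + 1))
  have hv1' : (⌊v⌋₊ : ℝ) ≤ v := by exact_mod_cast hv1
  have hv2' : (v : ℝ) ≤ ⌊v⌋₊ + 1 := by exact_mod_cast hv2
  have h5 : ε * (⌊v⌋₊ : ℝ) ≤ ε * v := by gcongr
  push_cast at h2 h4
  rw [abs_le]
  constructor <;> nlinarith [h3.1, h4.2]

end lln

/-! ### Stability of the fluid equation and the pathwise fluid limit. -/

section fluid

variable {d k : ℕ} {T : ℝ} {x₀ : EuclideanSpace ℝ (Fin d)} {l : Fin k → Fin d → ℤ}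
  {g : Fin k → ℝ → EuclideanSpace ℝ (Fin d) → ℝ}

theorem IsFluidSolution.continuousOn (hT : 0 ≤ T) {z : ℝ → EuclideanSpace ℝ (Fin d)}
    (hz : IsFluidSolution T x₀ l g z) : ContinuousOn z (Icc 0 T) := by
  have h : ContinuousOn (fun t => x₀ + ∑ i, (∫ s in (0 : ℝ)..t, g i s (z s)) • toEuclidean (l i))
      (Icc 0 T) := by
    refine continuousOn_const.add (continuousOn_finsetSum _ fun i _ => ContinuousOn.fun_smul ?_
      continuousOn_const)
    have := intervalIntegral.continuousOn_primitive_interval' (hz.integrable i) left_mem_uIcc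
    rwa [uIcc_of_le hT] at this
  exact h.congr hz.equation

/-- A path satisfying the fluid equation up to an error `δ` is close to the solution. -/
theorem IsFluidSolution.norm_sub_le (hT : 0 ≤ T) {M : ℝ} (hM : 0 ≤ M)
    (hLip : ∀ t ∈ Icc 0 T, ∀ x y, ‖drift l g t x - drift l g t y‖ ≤ M * ‖x - y‖)
    {z y : ℝ → EuclideanSpace ℝ (Fin d)} (hz : IsFluidSolution T x₀ l g z)
    (hy : ∀ i, IntervalIntegrable (fun s => g i s (y s)) volume 0 T)
    (hym : AEStronglyMeasurable y (volume.restrict (Ioc 0 T))) {B : ℝ}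
    (hyB : ∀ t ∈ Icc 0 T, ‖y t‖ ≤ B) {δ : ℝ} (hδ : 0 ≤ δ)
    (heq : ∀ t ∈ Icc 0 T,
      ‖y t - (x₀ + ∑ i, (∫ s in (0 : ℝ)..t, g i s (y s)) • toEuclidean (l i))‖ ≤ δ) :
    ∀ t ∈ Icc 0 T, ‖y t - z t‖ ≤ 2 * δ * Real.exp (2 * M * T) := by
  have hzc := hz.continuousOn hT
  obtain ⟨B', hB'⟩ := isCompact_Icc.exists_bound_of_continuousOn hzc
  have hB : ∀ t ∈ Icc 0 T, ‖y t - z t‖ ≤ B + B' := fun t ht =>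
    (_root_.norm_sub_le _ _).trans (add_le_add (hyB t ht) (hB' t ht))
  have hzm : AEStronglyMeasurable z (volume.restrict (Ioc 0 T)) :=
    (hzc.mono Ioc_subset_Icc_self).aestronglyMeasurable measurableSet_Ioc
  have hint : IntervalIntegrable (fun t => ‖y t - z t‖) volume 0 T := by
    rw [intervalIntegrable_iff_integrableOn_Ioc_of_le hT]
    refine Integrable.of_bound (hym.sub hzm).norm (B + B') ?_
    filter_upwards [ae_restrict_mem measurableSet_Ioc] with t ht
    rw [norm_norm]
    exact hB t ⟨ht.1.le, ht.2⟩
  refine le_of_le_add_mul_integral hδ hM hint hB fun t ht => ?_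
  have hsub : ∀ {φ : ℝ → ℝ}, IntervalIntegrable φ volume 0 T → IntervalIntegrable φ volume 0 t :=
    fun h => h.mono_set (by
      rw [uIcc_of_le ht.1, uIcc_of_le hT]; exact Icc_subset_Icc_right ht.2)
  set e := x₀ + ∑ i, (∫ s in (0 : ℝ)..t, g i s (y s)) • toEuclidean (l i) with he
  -- The rates are recombined into the drift, for which alone a Lipschitz bound is available.
  have h1 : e - z t = ∫ s in (0 : ℝ)..t, (drift l g s (y s) - drift l g s (z s)) := by
    rw [he, hz.equation t ht]
    simp only [drift]
    have hi : ∀ {w : ℝ → EuclideanSpace ℝ (Fin d)},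
        (∀ i, IntervalIntegrable (fun s => g i s (w s)) volume 0 T) →
        ∀ i ∈ Finset.univ, IntervalIntegrable (fun s => g i s (w s) • toEuclidean (l i)) volume 0 t :=
      fun h i _ => ⟨(hsub (h i)).1.smul_const _, (hsub (h i)).2.smul_const _⟩
    rw [intervalIntegral.integral_sub, intervalIntegral.integral_finsetSum (hi hy),
      intervalIntegral.integral_finsetSum (hi hz.integrable)]
    · simp only [intervalIntegral.integral_smul_const]
      abel
    · exact ⟨integrable_finsetSum _ fun i h => (hi hy i h).1,
        integrable_finsetSum _ fun i h => (hi hy i h).2⟩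
    · exact ⟨integrable_finsetSum _ fun i h => (hi hz.integrable i h).1,
        integrable_finsetSum _ fun i h => (hi hz.integrable i h).2⟩
  have h2 : ‖e - z t‖ ≤ M * ∫ s in (0 : ℝ)..t, ‖y s - z s‖ := by
    rw [h1, ← intervalIntegral.integral_const_mul]
    refine intervalIntegral.norm_integral_le_of_norm_le ht.1 ?_ ((hsub hint).const_mul M)
    exact Eventually.of_forall fun s hs => hLip s ⟨hs.1.le, hs.2.trans ht.2⟩ _ _
  calc ‖y t - z t‖ = ‖(y t - e) + (e - z t)‖ := by rw [sub_add_sub_cancel]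
    _ ≤ ‖y t - e‖ + ‖e - z t‖ := norm_add_le _ _
    _ ≤ _ := add_le_add (heq t ht) h2

/-- Pathwise fluid limit: along driving paths obeying the law of large numbers, the scaled solutions
converge uniformly to the fluid solution. -/
theorem IsFluidSolution.tendstoUniformlyOn (hT : 0 ≤ T) {M : ℝ} (hM : 0 ≤ M)
    (hLip : ∀ t ∈ Icc 0 T, ∀ x y, ‖drift l g t x - drift l g t y‖ ≤ M * ‖x - y‖)
    {C : ℝ} (hC : 0 ≤ C) (hgrowth : ∀ i, ∀ t ∈ Icc 0 T, ∀ x, g i t x ≤ C * (1 + ‖x‖))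
    {z : ℝ → EuclideanSpace ℝ (Fin d)} (hz : IsFluidSolution T x₀ l g z)
    {w : Fin k → ℝ≥0 → ℕ} (hw : ∀ i, Monotone (w i))
    (hlln : ∀ i, ∀ ε : ℝ, 0 < ε → ∃ K : ℝ, ∀ v : ℝ≥0, |(w i v : ℝ) - v| ≤ K + ε * v)
    {y : ℕ → ℝ → EuclideanSpace ℝ (Fin d)}
    (hnonneg : ∀ n : ℕ, 1 ≤ n → ∀ i, ∀ t ∈ Icc 0 T, 0 ≤ g i t (y n t))
    (hint : ∀ n : ℕ, 1 ≤ n → ∀ i, IntervalIntegrable (fun s => g i s (y n s)) volume 0 T)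
    (heq : ∀ n : ℕ, 1 ≤ n → ∀ t ∈ Icc 0 T, y n t = x₀ + ∑ i, ((1 / (n : ℝ)) *
      (w i (∫ s in (0 : ℝ)..t, (n : ℝ) * g i s (y n s)).toNNReal : ℝ)) • toEuclidean (l i)) :
    TendstoUniformlyOn y z atTop (Icc 0 T) := by
  set η : ℕ → Fin k → ℝ → ℝ := fun n i t => ∫ s in (0 : ℝ)..t, g i s (y n s) with hη
  set L := ∑ i, ‖toEuclidean (l i)‖ with hL
  have hL0 : 0 ≤ L := Finset.sum_nonneg fun _ _ => norm_nonneg _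
  have hsub : ∀ {φ : ℝ → ℝ} {t : ℝ}, t ∈ Icc 0 T → IntervalIntegrable φ volume 0 T →
      IntervalIntegrable φ volume 0 t := fun ht h => h.mono_set (by
    rw [uIcc_of_le ht.1, uIcc_of_le hT]; exact Icc_subset_Icc_right ht.2)
  have hη0 : ∀ n : ℕ, 1 ≤ n → ∀ i, ∀ t ∈ Icc 0 T, 0 ≤ η n i t := fun n hn i t ht =>
    intervalIntegral.integral_nonneg ht.1 fun s hs => hnonneg n hn i s ⟨hs.1, hs.2.trans ht.2⟩
  have hηmono : ∀ n : ℕ, 1 ≤ n → ∀ i, MonotoneOn (η n i) (Icc 0 T) := fun n hn i s hs t ht hst => by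
    refine intervalIntegral.integral_mono_interval le_rfl hs.1 hst ?_ (hsub ht (hint n hn i))
    filter_upwards [ae_restrict_mem measurableSet_Ioc] with v hv
    exact hnonneg n hn i v ⟨hv.1.le, hv.2.trans ht.2⟩
  have heq' : ∀ n : ℕ, 1 ≤ n → ∀ t ∈ Icc 0 T, y n t = x₀ + ∑ i, ((1 / (n : ℝ)) *
      (w i ((n : ℝ) * η n i t).toNNReal : ℝ)) • toEuclidean (l i) := by
    intro n hn t ht
    rw [heq n hn t ht]
    simp only [hη, intervalIntegral.integral_const_mul]
  have hwmono : ∀ n : ℕ, 1 ≤ n → ∀ i,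
      MonotoneOn (fun t => (w i ((n : ℝ) * η n i t).toNNReal : ℝ)) (Icc 0 T) := by
    intro n hn i s hs t ht hst
    have := hηmono n hn i hs ht hst
    dsimp only
    exact Nat.cast_le.2 (hw i (Real.toNNReal_mono (by gcongr)))
  -- Measurability in time comes from the monotone jump counts.
  have hym : ∀ n : ℕ, 1 ≤ n → AEStronglyMeasurable (y n) (volume.restrict (Ioc 0 T)) := by
    intro n hn
    have h1 : ∀ i, AEMeasurable (fun t => (w i ((n : ℝ) * η n i t).toNNReal : ℝ))
        (volume.restrict (Ioc 0 T)) := fun i =>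
      aemeasurable_restrict_of_monotoneOn measurableSet_Ioc
        ((hwmono n hn i).mono Ioc_subset_Icc_self)
    have h2 : AEStronglyMeasurable (fun t => x₀ + ∑ i, ((1 / (n : ℝ)) *
        (w i ((n : ℝ) * η n i t).toNNReal : ℝ)) • toEuclidean (l i)) (volume.restrict (Ioc 0 T)) :=
      aestronglyMeasurable_const.add (Finset.aestronglyMeasurable_fun_sum _ fun i _ =>
        ((h1 i).const_mul _).aestronglyMeasurable.smul aestronglyMeasurable_const)
    refine h2.congr ?_
    filter_upwards [ae_restrict_mem measurableSet_Ioc] with t ht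
    exact (heq' n hn t ⟨ht.1.le, ht.2⟩).symm
  -- The law of large numbers at `v = n η`, divided by `n`.
  have hdev : ∀ (K ε : ℝ) (n : ℕ), 1 ≤ n → ∀ i, ∀ t ∈ Icc 0 T,
      (∀ v : ℝ≥0, |(w i v : ℝ) - v| ≤ K + ε * v) →
      |(1 / (n : ℝ)) * (w i ((n : ℝ) * η n i t).toNNReal : ℝ) - η n i t| ≤
        K / n + ε * η n i t := by
    intro K ε n hn i t ht h
    have hn0 : (0 : ℝ) < n := Nat.cast_pos.2 hn
    have h1 := h ((n : ℝ) * η n i t).toNNReal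
    rw [Real.coe_toNNReal _ (mul_nonneg hn0.le (hη0 n hn i t ht))] at h1
    have h2 : (1 / (n : ℝ)) * (w i ((n : ℝ) * η n i t).toNNReal : ℝ) - η n i t =
        ((w i ((n : ℝ) * η n i t).toNNReal : ℝ) - n * η n i t) / n := by field_simp
    rw [h2, abs_div, abs_of_pos hn0, div_le_iff₀ hn0]
    refine h1.trans (le_of_eq ?_)
    field_simp
  -- Taking `ε = 1` gives `w(n η)/n ≤ K₁ + 2 η`; with linear growth of the rates, Grönwall then
  -- bounds the paths.
  choose K₁ hK₁ using fun i => hlln i 1 one_pos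
  have hK₁0 : ∀ i, 0 ≤ K₁ i := fun i => by
    have := (abs_nonneg _).trans (hK₁ i 0)
    simpa using this
  -- a bound on the paths that is uniform in `n`
  set a := ‖x₀‖ + ∑ i, ‖toEuclidean (l i)‖ * (K₁ i + 2 * (C * T)) with ha
  have ha0 : 0 ≤ a := add_nonneg (norm_nonneg _)
    (Finset.sum_nonneg fun i _ => mul_nonneg (norm_nonneg _)
      (add_nonneg (hK₁0 i) (by positivity)))
  set b := L * (2 * C) with hb
  set B := 2 * a * Real.exp (2 * b * T) with hB
  have hnormle : ∀ n : ℕ, 1 ≤ n → ∀ t ∈ Icc 0 T, ‖y n t‖ ≤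
      ‖x₀‖ + ∑ i, ‖toEuclidean (l i)‖ * (K₁ i + 2 * η n i t) := by
    intro n hn t ht
    rw [heq' n hn t ht]
    refine (norm_add_le _ _).trans ?_
    gcongr
    refine (norm_sum_le _ _).trans (Finset.sum_le_sum fun i _ => ?_)
    rw [norm_smul, mul_comm]
    gcongr
    have h1 := (abs_le.1 (hdev (K₁ i) 1 n hn i t ht (hK₁ i))).2
    have h2 : K₁ i / n ≤ K₁ i := div_le_self (hK₁0 i) (by exact_mod_cast hn)
    rw [Real.norm_of_nonneg (by positivity)]
    linarith
  have hyint : ∀ n : ℕ, 1 ≤ n → IntervalIntegrable (fun t => ‖y n t‖) volume 0 T := by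
    intro n hn
    rw [intervalIntegrable_iff_integrableOn_Ioc_of_le hT]
    refine Integrable.of_bound (hym n hn).norm
      (‖x₀‖ + ∑ i, ‖toEuclidean (l i)‖ * (K₁ i + 2 * η n i T)) ?_
    filter_upwards [ae_restrict_mem measurableSet_Ioc] with t ht
    rw [norm_norm]
    have ht' : t ∈ Icc 0 T := ⟨ht.1.le, ht.2⟩
    refine (hnormle n hn t ht').trans ?_
    gcongr with i
    exact hηmono n hn i ht' ⟨hT, le_rfl⟩ ht.2
  have hηle : ∀ n : ℕ, 1 ≤ n → ∀ i, ∀ t ∈ Icc 0 T,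
      η n i t ≤ C * T + C * ∫ s in (0 : ℝ)..t, ‖y n s‖ := by
    intro n hn i t ht
    have h1 := hsub ht (hyint n hn)
    have h2 : η n i t ≤ ∫ s in (0 : ℝ)..t, C * (1 + ‖y n s‖) :=
      intervalIntegral.integral_mono_on ht.1 (hsub ht (hint n hn i))
        ((intervalIntegrable_const.add h1).const_mul C)
        fun s hs => hgrowth i s ⟨hs.1, hs.2.trans ht.2⟩ _
    rw [intervalIntegral.integral_const_mul, intervalIntegral.integral_add intervalIntegrable_const
      h1, intervalIntegral.integral_const, smul_eq_mul, mul_one, sub_zero, mul_add] at h2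
    have h3 : C * t ≤ C * T := by gcongr; exact ht.2
    linarith
  have hyB : ∀ n : ℕ, 1 ≤ n → ∀ t ∈ Icc 0 T, ‖y n t‖ ≤ B := by
    intro n hn
    refine le_of_le_add_mul_integral
      (B := ‖x₀‖ + ∑ i, ‖toEuclidean (l i)‖ * (K₁ i + 2 * η n i T)) ha0 (by positivity)
      (hyint n hn) ?_ ?_
    · intro t ht
      refine (hnormle n hn t ht).trans ?_
      gcongr with i
      exact hηmono n hn i ht ⟨hT, le_rfl⟩ ht.2
    · intro t ht
      refine (hnormle n hn t ht).trans ?_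
      have h1 : ∑ i, ‖toEuclidean (l i)‖ * (K₁ i + 2 * η n i t) ≤
          ∑ i, (‖toEuclidean (l i)‖ * (K₁ i + 2 * (C * T)) +
            ‖toEuclidean (l i)‖ * (2 * C * ∫ s in (0 : ℝ)..t, ‖y n s‖)) := by
        refine Finset.sum_le_sum fun i _ => ?_
        rw [← mul_add]
        refine mul_le_mul_of_nonneg_left ?_ (norm_nonneg _)
        have := hηle n hn i t ht
        linarith
      rw [Finset.sum_add_distrib, ← Finset.sum_mul, ← hL] at h1
      rw [ha, hb]
      linarith
  set U := C * (1 + B) * T with hU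
  have hB0 : 0 ≤ B := by positivity
  have hηU : ∀ n : ℕ, 1 ≤ n → ∀ i, ∀ t ∈ Icc 0 T, η n i t ≤ U := by
    intro n hn i t ht
    refine (hηmono n hn i ht ⟨hT, le_rfl⟩ ht.2).trans ?_
    have := intervalIntegral.integral_mono_on hT (hint n hn i)
      (intervalIntegrable_const (c := C * (1 + B))) fun s hs =>
        (hgrowth i s hs _).trans (by gcongr; exact hyB n hn s hs)
    rwa [intervalIntegral.integral_const, smul_eq_mul, sub_zero, mul_comm T] at this
  rw [Metric.tendstoUniformlyOn_iff]
  intro ε₀ hε₀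
  set c := 2 * (L * (1 + U)) * Real.exp (2 * M * T) with hc
  have hU0 : 0 ≤ U := by positivity
  have hc0 : 0 ≤ c := by positivity
  -- The final error is `ε c < ε₀`; the `+ 1` covers `c = 0`.
  set ε := ε₀ / (c + 1) with hε
  have hεpos : 0 < ε := by positivity
  choose K hK using fun i => hlln i ε hεpos
  have hev : ∀ᶠ n : ℕ in atTop, ∀ i, K i / n ≤ ε := by
    refine eventually_all.2 fun i => ?_
    exact ((tendsto_const_div_atTop_nhds_zero_nat (K i)).eventually (ge_mem_nhds hεpos))
  filter_upwards [hev, eventually_ge_atTop 1] with n hn hn1 t ht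
  have hmain := hz.norm_sub_le hT hM hLip (hint n hn1) (hym n hn1) (hyB n hn1)
    (δ := L * (ε + ε * U)) (by positivity) (fun s hs => ?_) t ht
  · rw [dist_comm, dist_eq_norm]
    refine hmain.trans_lt ?_
    have h1 : 2 * (L * (ε + ε * U)) * Real.exp (2 * M * T) = ε * c := by rw [hc]; ring
    rw [h1, hε, div_mul_eq_mul_div, div_lt_iff₀ (by positivity)]
    linarith
  · rw [heq' n hn1 s hs, add_sub_add_left_eq_sub, ← Finset.sum_sub_distrib]
    refine (norm_sum_le _ _).trans ?_
    rw [hL, Finset.sum_mul]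
    refine Finset.sum_le_sum fun i _ => ?_
    rw [← sub_smul, norm_smul, mul_comm]
    gcongr
    refine (hdev (K i) ε n hn1 i s hs (hK i)).trans ?_
    have := hηU n hn1 i s hs
    gcongr
    exact hn i

end fluid

end AdjustedFluid

namespace AdjustedFluid

/-! ### From states to jump counts. -/

section state

variable {d k : ℕ}

/-- The state reached from `x₀` after `a i` jumps `l i`. -/
noncomputable def stateOf (x₀ : EuclideanSpace ℝ (Fin d)) (l : Fin k → Fin d → ℤ)
    (a : Fin k → ℕ) : EuclideanSpace ℝ (Fin d) :=
  x₀ + ∑ i, (a i : ℝ) • toEuclidean (l i)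

theorem norm_stateOf_le (x₀ : EuclideanSpace ℝ (Fin d)) (l : Fin k → Fin d → ℤ) (a : Fin k → ℕ) :
    ‖stateOf x₀ l a‖ ≤ ‖x₀‖ + (∑ i, ‖toEuclidean (l i)‖) * ∑ i, (a i : ℝ) := by
  refine (norm_add_le _ _).trans ?_
  gcongr
  refine (norm_sum_le _ _).trans ?_
  rw [Finset.mul_sum]
  refine Finset.sum_le_sum fun i _ => ?_
  rw [norm_smul, mul_comm, Real.norm_of_nonneg (Nat.cast_nonneg _)]
  gcongr
  exact Finset.single_le_sum (f := fun i => ‖toEuclidean (l i)‖) (fun _ _ => norm_nonneg _)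
    (Finset.mem_univ i)

variable {T : ℝ} {x₀ : EuclideanSpace ℝ (Fin d)} {l : Fin k → Fin d → ℤ}
  {f : Fin k → ℝ → EuclideanSpace ℝ (Fin d) → ℝ}

/-- The rates as functions of the jump counts, cut off at `0` and outside `[0, T]`. -/
noncomputable def countRate (T : ℝ) (x₀ : EuclideanSpace ℝ (Fin d)) (l : Fin k → Fin d → ℤ)
    (f : Fin k → ℝ → EuclideanSpace ℝ (Fin d) → ℝ) (i : Fin k) (t : ℝ) (a : Fin k → ℕ) : ℝ :=
  (Icc 0 T).indicator (fun t => max 0 (f i t (stateOf x₀ l a))) t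

/-- The cutoff is needed because `f i` may be negative at states that `X` does not visit; along `X`
it almost surely does not act. -/
theorem countRate_eq {i : Fin k} {t : ℝ} {a : Fin k → ℕ} (ht : t ∈ Icc 0 T)
    (h : 0 ≤ f i t (stateOf x₀ l a)) : countRate T x₀ l f i t a = f i t (stateOf x₀ l a) := by
  rw [countRate, indicator_of_mem ht, max_eq_right h]

theorem isRate_countRate
    (hf : ∀ i, ContinuousOn (Function.uncurry (f i)) (Icc 0 T ×ˢ univ)) {C : ℝ} (hC : 0 ≤ C)
    (hgrowth : ∀ i, ∀ t ∈ Icc 0 T, ∀ x, |f i t x| ≤ C * (1 + ‖x‖)) :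
    IsRate (countRate T x₀ l f) (C * (1 + ‖x₀‖ + ∑ i, ‖toEuclidean (l i)‖)) where
  nonneg i t a := indicator_nonneg (fun _ _ => le_max_left _ _) _
  meas i a := by
    have h1 : ContinuousOn (fun t => f i t (stateOf x₀ l a)) (Icc 0 T) :=
      (hf i).comp (f := fun t => (t, stateOf x₀ l a)) (by fun_prop)
        fun t ht => ⟨ht, mem_univ _⟩
    classical
    have h2 : ContinuousOn (fun t => max 0 (f i t (stateOf x₀ l a))) (Icc 0 T) :=
      continuousOn_const.sup h1
    have h3 := h2.measurable_piecewise (g := 0) continuousOn_const measurableSet_Icc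
    rw [Set.piecewise_eq_indicator] at h3
    exact h3
  le i t a := by
    have hL : 0 ≤ ∑ i, ‖toEuclidean (l i)‖ := Finset.sum_nonneg fun _ _ => norm_nonneg _
    have ha : 0 ≤ ∑ i, (a i : ℝ) := Finset.sum_nonneg fun _ _ => Nat.cast_nonneg _
    rw [countRate]
    by_cases ht : t ∈ Icc 0 T
    · rw [indicator_of_mem ht]
      refine max_le (by positivity) ((le_abs_self _).trans ((hgrowth i t ht _).trans ?_))
      rw [mul_assoc]
      refine mul_le_mul_of_nonneg_left ?_ hC
      have := norm_stateOf_le x₀ l a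
      nlinarith [norm_nonneg x₀, mul_nonneg (norm_nonneg x₀) ha]
    · rw [indicator_of_notMem ht]
      positivity

end state

end AdjustedFluid

/-! ### The main theorem. -/

theorem theorem4 {d k : ℕ} {Ω : Type*} [MeasurableSpace Ω] (P : Measure Ω)
    [IsProbabilityMeasure P] (T : ℝ) (hT : 0 ≤ T)
    (x₀ : EuclideanSpace ℝ (Fin d)) (l : Fin k → Fin d → ℤ)
    -- independent Poisson processes of rate one
    (Y : Fin k → ℝ≥0 → Ω → ℕ)
    (hY : ∀ i, AdjustedFluid.IsUnitPoissonProcess P (Y i))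
    (hYindep : iIndepFun (fun i ω t => Y i t ω) P)
    -- continuous rate functions of linear growth, with Lipschitz drift
    (f : Fin k → ℝ → EuclideanSpace ℝ (Fin d) → ℝ)
    (hf : ∀ i, ContinuousOn (Function.uncurry (f i)) (Icc 0 T ×ˢ univ))
    (C : Fin k → ℝ)
    (hgrowth : ∀ i, ∀ t ∈ Icc 0 T, ∀ x, |f i t x| ≤ C i * (1 + ‖x‖))
    (M : ℝ)
    (hLip : ∀ t ∈ Icc 0 T, ∀ x y,
      ‖AdjustedFluid.drift l f t x - AdjustedFluid.drift l f t y‖ ≤ M * ‖x - y‖)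
    -- the original process
    (X : ℝ → Ω → EuclideanSpace ℝ (Fin d))
    (hX : AdjustedFluid.IsScaledSolution P T x₀ l Y f 1 X)
    -- the scaled processes driven by the adjusted rates
    (Z : ℕ → ℝ → Ω → EuclideanSpace ℝ (Fin d))
    (hZ : ∀ n, 1 ≤ n → AdjustedFluid.IsScaledSolution P T x₀ l Y
      (AdjustedFluid.adjustedRate P X f) n (Z n)) :
    -- all the expectations below (and those defining the adjusted rates) exist
    (∀ t ∈ Icc 0 T, Integrable (X t) P) ∧
    (∀ i, ∀ t ∈ Icc 0 T, ∀ m,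
      Integrable (fun ω => f i t (X t ω - (∫ ω', X t ω' ∂P) + m)) P) ∧
    (∀ i, ∀ t ∈ Icc 0 T, Integrable (fun ω => f i t (X t ω)) P) ∧
    (∀ i, IntervalIntegrable (fun s => ∫ ω, f i s (X s ω) ∂P) volume 0 T) ∧
    ∃ Zbar : ℝ → EuclideanSpace ℝ (Fin d),
      -- `Zbar` is the unique solution of the adjusted fluid equation
      AdjustedFluid.IsFluidSolution T x₀ l (AdjustedFluid.adjustedRate P X f) Zbar ∧
      (∀ z, AdjustedFluid.IsFluidSolution T x₀ l (AdjustedFluid.adjustedRate P X f) z →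
        EqOn z Zbar (Icc 0 T)) ∧
      -- almost sure convergence, uniformly on `[0,T]`
      (∀ᵐ ω ∂P, TendstoUniformlyOn (fun n t => Z n t ω) Zbar atTop (Icc 0 T)) ∧
      -- the fluid limit is the exact mean
      ∀ t ∈ Icc 0 T,
        Zbar t = ∫ ω, X t ω ∂P ∧
        ∫ ω, X t ω ∂P = x₀ + ∑ i,
          (∫ s in (0 : ℝ)..t, ∫ ω, f i s (X s ω) ∂P) • AdjustedFluid.toEuclidean (l i) := by
  set C₀ := ∑ i, |C i| with hC₀
  have hC₀0 : 0 ≤ C₀ := Finset.sum_nonneg fun _ _ => abs_nonneg _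
  have hgrowth' : ∀ i, ∀ t ∈ Icc 0 T, ∀ x, |f i t x| ≤ C₀ * (1 + ‖x‖) := by
    intro i t ht x
    refine (hgrowth i t ht x).trans ?_
    gcongr
    exact (le_abs_self _).trans
      (Finset.single_le_sum (f := fun i => |C i|) (fun _ _ => abs_nonneg _) (Finset.mem_univ i))
  set L := ∑ i, ‖AdjustedFluid.toEuclidean (l i)‖ with hL
  have hL0 : 0 ≤ L := Finset.sum_nonneg fun _ _ => norm_nonneg _
  set r := AdjustedFluid.countRate T x₀ l f with hr
  have hrate : AdjustedFluid.IsRate r (C₀ * (1 + ‖x₀‖ + L)) :=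
    AdjustedFluid.isRate_countRate hf hC₀0 hgrowth'
  set A : Ω → ℝ → Fin k → ℕ := fun ω t i => Y i (∫ s in (0 : ℝ)..t, f i s (X s ω)).toNNReal ω
    with hA
  -- the jump counts solve the time change equation
  have hXA : ∀ᵐ ω ∂P, ∀ t ∈ Icc 0 T, X t ω = AdjustedFluid.stateOf x₀ l (A ω t) ∧
      ∀ i, r i t (A ω t) = f i t (X t ω) := by
    filter_upwards [hX.equation, hX.nonneg] with ω h1 h2 t ht
    have h3 : X t ω = AdjustedFluid.stateOf x₀ l (A ω t) := by
      simpa [AdjustedFluid.stateOf, hA] using h1 t ht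
    refine ⟨h3, fun i => ?_⟩
    have h4 := h2 i t ht
    rw [h3] at h4 ⊢
    exact AdjustedFluid.countRate_eq ht h4
  have hsolves : ∀ᵐ ω ∂P, AdjustedFluid.SolvesUpTo (AdjustedFluid.paths Y ω) r T (A ω) := by
    filter_upwards [hXA, hX.integrable] with ω h1 h2
    refine ⟨fun i => (intervalIntegrable_congr fun s hs => ?_).1 (h2 i), fun t ht => ?_⟩
    · rw [uIoc_of_le hT] at hs
      exact ((h1 s ⟨hs.1.le, hs.2⟩).2 i).symm
    · funext i
      simp only [hA, AdjustedFluid.timeChange, AdjustedFluid.paths, AdjustedFluid.clock]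
      congr 2
      refine intervalIntegral.integral_congr fun s hs => ?_
      rw [uIcc_of_le ht.1] at hs
      exact ((h1 s ⟨hs.1, hs.2.trans ht.2⟩).2 i).symm
  obtain ⟨⟨K, hK⟩, hAint, hrint, hrInt, hmean⟩ :=
    hrate.moments (by positivity) hY hYindep hT hsolves
  have hrf : ∀ t ∈ Icc 0 T, ∀ i, (fun ω => r i t (A ω t)) =ᵐ[P] fun ω => f i t (X t ω) :=
    fun t ht i => by filter_upwards [hXA] with ω h using (h t ht).2 i
  have hXs : ∀ t ∈ Icc 0 T, (fun ω => AdjustedFluid.stateOf x₀ l (A ω t)) =ᵐ[P] X t :=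
    fun t ht => by filter_upwards [hXA] with ω h using (h t ht).1.symm
  have hsint : ∀ t ∈ Icc 0 T, ∀ i ∈ Finset.univ,
      Integrable (fun ω => (A ω t i : ℝ) • AdjustedFluid.toEuclidean (l i)) P :=
    fun t ht i _ => (hAint t ht i).smul_const _
  have hXint : ∀ t ∈ Icc 0 T, Integrable (X t) P := fun t ht =>
    ((integrable_const x₀).add (integrable_finsetSum _ (hsint t ht))).congr (hXs t ht)
  have hfint : ∀ i, ∀ t ∈ Icc 0 T, Integrable (fun ω => f i t (X t ω)) P := fun i t ht =>
    (hrint t ht i).congr (hrf t ht i)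
  have hfE : ∀ i, ∀ t ∈ Icc 0 T, ∫ ω, r i t (A ω t) ∂P = ∫ ω, f i t (X t ω) ∂P := fun i t ht =>
    integral_congr_ae (hrf t ht i)
  have hfInt : ∀ i, IntervalIntegrable (fun s => ∫ ω, f i s (X s ω) ∂P) volume 0 T := fun i => by
    refine (intervalIntegrable_congr fun s hs => ?_).1 (hrInt i)
    rw [uIoc_of_le hT] at hs
    exact hfE i s ⟨hs.1.le, hs.2⟩
  have hXE : ∀ t ∈ Icc 0 T, ∫ ω, X t ω ∂P = x₀ + ∑ i,
      (∫ s in (0 : ℝ)..t, ∫ ω, f i s (X s ω) ∂P) • AdjustedFluid.toEuclidean (l i) := by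
    intro t ht
    rw [← integral_congr_ae (hXs t ht)]
    simp only [AdjustedFluid.stateOf]
    rw [integral_add (integrable_const x₀) (integrable_finsetSum _ (hsint t ht)),
      integral_finsetSum _ (hsint t ht)]
    simp only [integral_const, probReal_univ, one_smul]
    congr 1
    refine Finset.sum_congr rfl fun i _ => ?_
    rw [integral_smul_const, hmean t ht i]
    congr 1
    refine intervalIntegral.integral_congr fun s hs => ?_
    rw [uIcc_of_le ht.1] at hs
    exact hfE i s ⟨hs.1, hs.2.trans ht.2⟩
  set B := ‖x₀‖ + L * K with hB
  have hXB : ∀ t ∈ Icc 0 T, ∫ ω, ‖X t ω‖ ∂P ≤ B := by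
    intro t ht
    have hi : Integrable (fun ω => ∑ j, (A ω t j : ℝ)) P :=
      integrable_finsetSum _ fun i _ => hAint t ht i
    calc ∫ ω, ‖X t ω‖ ∂P ≤ ∫ ω, (‖x₀‖ + L * ∑ j, (A ω t j : ℝ)) ∂P := by
          refine integral_mono_ae (hXint t ht).norm ((integrable_const _).add (hi.const_mul _)) ?_
          filter_upwards [hXA] with ω h
          rw [(h t ht).1]
          exact AdjustedFluid.norm_stateOf_le _ _ _
      _ = ‖x₀‖ + L * ∫ ω, ∑ j, (A ω t j : ℝ) ∂P := by
          rw [integral_add (integrable_const _) (hi.const_mul _), integral_const_mul]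
          simp
      _ ≤ B := by rw [hB]; gcongr; exact hK t ht
  have hμB : ∀ t ∈ Icc 0 T, ‖∫ ω, X t ω ∂P‖ ≤ B := fun t ht =>
    (norm_integral_le_integral_norm _).trans (hXB t ht)
  have hB0 : 0 ≤ B := (norm_nonneg _).trans (hμB 0 ⟨le_rfl, hT⟩)
  have hdom : ∀ t ∈ Icc 0 T, ∀ m : EuclideanSpace ℝ (Fin d), Integrable
      (fun ω => C₀ * (1 + (‖X t ω‖ + ‖∫ ω', X t ω' ∂P‖ + ‖m‖))) P := fun t ht m =>
    ((integrable_const _).add (((hXint t ht).norm.add (integrable_const _)).add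
      (integrable_const _))).const_mul _
  have hfdom : ∀ i, ∀ t ∈ Icc 0 T, ∀ m, ∀ ω, ‖f i t (X t ω - (∫ ω', X t ω' ∂P) + m)‖ ≤
      C₀ * (1 + (‖X t ω‖ + ‖∫ ω', X t ω' ∂P‖ + ‖m‖)) := by
    intro i t ht m ω
    refine (hgrowth' i t ht _).trans ?_
    gcongr
    exact (norm_add_le _ _).trans (by gcongr; exact norm_sub_le _ _)
  have hgint : ∀ i, ∀ t ∈ Icc 0 T, ∀ m,
      Integrable (fun ω => f i t (X t ω - (∫ ω', X t ω' ∂P) + m)) P := by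
    intro i t ht m
    have hc : Continuous (f i t) := by
      rw [← continuousOn_univ]
      exact (hf i).comp (f := fun x => (t, x)) (by fun_prop) fun x _ => ⟨ht, mem_univ _⟩
    have hm : Measurable fun ω => f i t (X t ω - (∫ ω', X t ω' ∂P) + m) :=
      hc.measurable.comp (((hX.measurable t ht).sub_const _).add_const _)
    exact (hdom t ht m).mono' hm.aestronglyMeasurable
      (Eventually.of_forall (hfdom i t ht m))
  refine ⟨hXint, hgint, hfint, hfInt, fun t => ∫ ω, X t ω ∂P, ?_⟩
  -- regularity of the adjusted rates
  set g := AdjustedFluid.adjustedRate P X f with hg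
  -- One `B` bounds `E‖X(t)‖`, the other `‖E[X(t)]‖`.
  have hggrowth : ∀ i, ∀ t ∈ Icc 0 T, ∀ m, g i t m ≤ (C₀ * (1 + 2 * B)) * (1 + ‖m‖) := by
    intro i t ht m
    calc g i t m ≤ ∫ ω, C₀ * (1 + (‖X t ω‖ + ‖∫ ω', X t ω' ∂P‖ + ‖m‖)) ∂P :=
          integral_mono (hgint i t ht m) (hdom t ht m)
            fun ω => (le_abs_self _).trans (hfdom i t ht m ω)
      _ = C₀ * (1 + (∫ ω, ‖X t ω‖ ∂P + ‖∫ ω', X t ω' ∂P‖ + ‖m‖)) := by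
          have h1 := (hXint t ht).norm
          have h2 : Integrable (fun ω => ‖X t ω‖ + ‖∫ ω', X t ω' ∂P‖) P := h1.add (integrable_const _)
          have h3 : Integrable (fun ω => ‖X t ω‖ + ‖∫ ω', X t ω' ∂P‖ + ‖m‖) P :=
            h2.add (integrable_const _)
          rw [integral_const_mul, integral_add (integrable_const _) h3,
            integral_add h2 (integrable_const _), integral_add h1 (integrable_const _)]
          simp
      _ ≤ C₀ * ((1 + 2 * B) * (1 + ‖m‖)) := by
          gcongr
          have := hXB t ht
          have := hμB t ht
          nlinarith [mul_nonneg hB0 (norm_nonneg m)]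
      _ = _ := by ring
  -- For every `ω` the two translated arguments differ by `x - y`, so the bound survives averaging.
  -- `M` may be negative when `d = 0`, hence `|M|`.
  have hgLip : ∀ t ∈ Icc 0 T, ∀ x y,
      ‖AdjustedFluid.drift l g t x - AdjustedFluid.drift l g t y‖ ≤ |M| * ‖x - y‖ := by
    intro t ht x y
    have hi : ∀ m, ∀ i ∈ Finset.univ, Integrable (fun ω =>
        f i t (X t ω - (∫ ω', X t ω' ∂P) + m) • AdjustedFluid.toEuclidean (l i)) P :=
      fun m i _ => (hgint i t ht m).smul_const _
    have hd : ∀ m, AdjustedFluid.drift l g t m =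
        ∫ ω, AdjustedFluid.drift l f t (X t ω - (∫ ω', X t ω' ∂P) + m) ∂P := by
      intro m
      simp only [AdjustedFluid.drift]
      rw [integral_finsetSum _ (hi m)]
      exact Finset.sum_congr rfl fun i _ => (integral_smul_const _ _).symm
    have hdi : ∀ m, Integrable (fun ω =>
        AdjustedFluid.drift l f t (X t ω - (∫ ω', X t ω' ∂P) + m)) P := fun m =>
      integrable_finsetSum _ (hi m)
    rw [hd, hd, ← integral_sub (hdi x) (hdi y)]
    refine (norm_integral_le_of_norm_le_const (C := |M| * ‖x - y‖)
      (Eventually.of_forall fun ω => ?_)).trans (by simp)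
    refine (hLip t ht _ _).trans ?_
    rw [add_sub_add_left_eq_sub]
    gcongr
    exact le_abs_self M
  have hmu : ∀ i s, g i s (∫ ω, X s ω ∂P) = ∫ ω, f i s (X s ω) ∂P := fun i s =>
    AdjustedFluid.adjustedRate_mean P X f i s
  -- The crux: at the mean the adjusted rates are the mean rates, so the equation for the mean
  -- closes.
  have hfluid : AdjustedFluid.IsFluidSolution T x₀ l g fun t => ∫ ω, X t ω ∂P := by
    refine ⟨fun i => ?_, fun t ht => ?_⟩
    · simpa only [hmu] using hfInt i
    · simpa only [hmu] using hXE t ht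
  refine ⟨hfluid, fun z hz t ht => ?_, ?_, fun t ht => ⟨rfl, hXE t ht⟩⟩
  · have hzc := hz.continuousOn hT
    obtain ⟨B', hB'⟩ := isCompact_Icc.exists_bound_of_continuousOn hzc
    -- Uniqueness is stability with error `δ = 0`.
    have := hfluid.norm_sub_le hT (abs_nonneg M) hgLip hz.integrable
      ((hzc.mono Ioc_subset_Icc_self).aestronglyMeasurable measurableSet_Ioc) hB' le_rfl
      (fun s hs => by rw [← hz.equation s hs, sub_self, norm_zero]) t ht
    rw [mul_zero, zero_mul] at this
    exact sub_eq_zero.1 (norm_le_zero_iff.1 this)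
  · have hZn : ∀ᵐ ω ∂P, ∀ n, 1 ≤ n → (∀ i, ∀ t ∈ Icc 0 T, 0 ≤ g i t (Z n t ω)) ∧
        (∀ i, IntervalIntegrable (fun s => g i s (Z n s ω)) volume 0 T) ∧
        ∀ t ∈ Icc 0 T, Z n t ω = x₀ + ∑ i, ((1 / (n : ℝ)) *
          (Y i (∫ s in (0 : ℝ)..t, (n : ℝ) * g i s (Z n s ω)).toNNReal ω : ℝ)) •
            AdjustedFluid.toEuclidean (l i) := by
      refine ae_all_iff.2 fun n => ?_
      by_cases hn : 1 ≤ n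
      · filter_upwards [(hZ n hn).nonneg, (hZ n hn).integrable, (hZ n hn).equation] with ω h1 h2 h3 _
        exact ⟨h1, h2, h3⟩
      · exact Eventually.of_forall fun ω h => absurd h hn
    filter_upwards [hZn, ae_all_iff.2 fun i => (hY i).monotone,
      ae_all_iff.2 fun i => (hY i).ae_abs_sub_le] with ω h1 h2 h3
    exact hfluid.tendstoUniformlyOn hT (abs_nonneg M) hgLip (by positivity) hggrowth h2 h3
      (fun n hn => (h1 n hn).1) (fun n hn => (h1 n hn).2.1) (fun n hn => (h1 n hn).2.2)
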